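/- **Setting.** Let $\mathcal A$ be a unital complex algebra and let $\varphi,\varphi':\mathcal A\to\mathbb C$ be linear with $\varphi(1)=1$, $\varphi'(1)=0$. Let $H=T(T_+(\mathcal A))$ be the double tensor algebra, where $T_+(\mathcal A)=\bigoplus_{n\ge1}\mathcal A^{\otimes n}$ is spanned by words $a_1\cdots a_n$ and the product of $H$ is written $u|v$; let $\mathbf 1$ be its unit and $H_+=T_+(T_+(\mathcal A))$ its augmentation ideal. For $S\subseteq[n]$ let $a_S$ be the subword of $a_1\cdots a_n$ at the positions in $S$ ($a_\emptyset=\mathbf 1$) and let $J_1,\dots,J_k$ be the interval components of $[n]\setminus S$ from left to right. The coproduct $\Delta:H\to H\otimes H$ is the algebra homomorphism with $$\Delta(a_1\cdots a_n)=\sum_{S\subseteq[n]}a_S\otimes a_{J_1}|\cdots|a_{J_k}.$$ The half-coproducts $\Delta_\prec$, $\Delta_\succ$ are given on words by the same sum restricted to $1\in S$, respectively $1\notin S$, and by $\Delta_\prec(w|u)=\Delta_\prec(w)\Delta(u)$, $\Delta_\succ(w|u)=\Delta_\succ(w)\Delta(u)$ for $w\in T_+(\mathcal A)$, $u\in H$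 (and by $0$ at $\mathbf 1$). For a commutative $\mathbb C$-algebra $R$ and linear $f,g:H\to R$ put $f\star g=m_R(f\otimes g)\Delta$, $f\prec g=m_R(f\otimes g)\Delta_\prec$, $f\succ g=m_R(f\otimes g)\Delta_\succ$. Let $\varepsilon$ be the counit, and let $\exp^\star(f)=\sum_{n\ge0}f^{\star n}/n!$. A linear map $f:H\to R$ is an infinitesimal character if $f(\mathbf 1)=0$ and $f(u|v)=0$ for all $u,v\in H_+$. Let $\mathbb G=\mathbb C[\hbar]/(\hbar^2)$, and let $\tilde\Phi=\Phi+\hbar\Phi':H\to\mathbb G$ be the algebra homomorphism with $\tilde\Phi(a_1\cdots a_n)=\varphi(a_1\cdots a_n)+\hbar\,\varphi'(a_1\cdots a_n)$ (on the right the products are taken in $\mathcal A$). Thus $\Phi:H\to\mathbb C$ is a character, and $\Phi'$ extends the moments of $\varphi'$ by the Leibniz rule $\Phi'(u|v)=\Phi(u)\Phi'(v)+\Phi'(u)\Phi(v)$. Let $\tilde\kappa=\kappa+\hbar\kappa'$, $\tilde\beta=\beta+\hbar\beta'$ and $\tilde\rho=\rho+\hbar\rho'$ be $\mathbb G$-valued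 infinitesimal characters on $H$ (the free, Boolean and monotone cumulant characters) with $$\tilde\Phi=\varepsilon+\tilde\kappa\prec\tilde\Phi,\qquad \tilde\Phi=\varepsilon+\tilde\Phi\succ\tilde\beta,\qquad \tilde\Phi=\exp^\star(\tilde\rho).$$ Write $\theta_\Psi(\alpha)=\Psi^{-1}\succ\alpha\prec\Psi$, where $\Psi^{-1}$ is the inverse for $\star$, write $\mathrm{ad}_\rho(\alpha)=\rho\star\alpha-\alpha\star\rho$, and $$W_\rho(\alpha)=\frac{e^{-\mathrm{ad}_\rho}-1}{-\mathrm{ad}_\rho}(\alpha)=\sum_{n\ge0}\frac{(-1)^n}{(n+1)!}\,\mathrm{ad}_\rho^{\,n}(\alpha).$$ **Proposition.** The character $\Phi$ is invertible for $\star$, the series $W_\rho(\rho')$ has only finitely many non-zero terms at each element of $H$, and $$\Phi'=\Phi\star\theta_\Phi(\kappa')=\theta_{\Phi^{-1}}(\beta')\star\Phi=\Phi\star W_\rho(\rho').$$ -/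

import Mathlib

open scoped TensorProduct

noncomputable section

namespace ShuffleCumulant

/-! ### The double tensor algebra -/

/-- The space of non-empty words `T₊(A) = ⨁_{n ≥ 1} A^{⊗ n}`
(the summand with index `n` is `A^{⊗ (n+1)}`). -/
abbrev Words (A : Type*) [Ring A] [Algebra ℂ A] : Type _ :=
  DirectSum ℕ (fun n => PiTensorProduct ℂ (fun _ : Fin (n + 1) => A))

/-- The double tensor algebra `H = T(T₊(A))`; its product is the bar product `u | v`. -/
abbrev DoubleTensor (A : Type*) [Ring A] [Algebra ℂ A] : Type _ :=
  TensorAlgebra ℂ (Words A)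

variable {A : Type*} [Ring A] [Algebra ℂ A]

/-- The element `a₁ ⊗ ⋯ ⊗ aₙ₊₁` of `T₊(A)`. -/
def pureWord (n : ℕ) (a : Fin (n + 1) → A) : Words A :=
  DirectSum.lof ℂ ℕ (fun n => PiTensorProduct ℂ (fun _ : Fin (n + 1) => A)) n
    (PiTensorProduct.tprod ℂ a)

/-- A list of letters as an element of `H`: the empty list is the unit `𝟏` of `H`, a non-empty
list is the word with these letters. -/
def word : List A → DoubleTensor A
  | [] => 1
  | a :: l => TensorAlgebra.ι ℂ (pureWord l.length (fun i => (a :: l).get i))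

theorem word_eq_of_length {n : ℕ} (l : List A) (h : l.length = n + 1) :
    word l = TensorAlgebra.ι ℂ (pureWord n (fun i => l.get (i.cast h.symm))) := by
  cases l with
  | nil => simp at h
  | cons a l =>
    obtain rfl : l.length = n := by simpa using h
    rfl

/-! ### The coproduct -/

/-- The elements of `S ⊆ {0, …, n-1}` in increasing order. -/
def positions {n : ℕ} (S : Finset (Fin n)) : List (Fin n) :=
  (List.finRange n).filter (fun i => decide (i ∈ S))

/-- The interval components `J₁, …, J_k`, from left to right, of the set with increasing
enumeration `l`: the list is cut wherever two neighbours are not consecutive integers. -/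
def intervals {n : ℕ} (l : List (Fin n)) : List (List (Fin n)) :=
  l.splitBy (fun i j => decide (i.val + 1 = j.val))

/-- `a_{J₁} | ⋯ | a_{J_k}` for a list of index lists. -/
def barWord {n : ℕ} (L : List (List (Fin n))) (a : Fin n → A) : DoubleTensor A :=
  (L.map (fun J => word (J.map a))).prod

theorem map_update_of_notMem {B : Type*} {n : ℕ} (l : List (Fin n)) (a : Fin n → B)
    (i : Fin n) (x : B) (h : i ∉ l) : l.map (Function.update a i x) = l.map a := by
  apply List.map_congr_left
  intro j hj
  rw [Function.update_of_ne]
  rintro rfl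
  exact h hj

theorem exists_linear_word {n : ℕ} (l : List (Fin n)) (hl : l.Nodup)
    (a : Fin n → A) (i : Fin n) (h : i ∈ l) :
    ∃ f : A →ₗ[ℂ] DoubleTensor A, ∀ x, word (l.map (Function.update a i x)) = f x := by
  obtain ⟨m, hm⟩ : ∃ m, l.length = m + 1 :=
    Nat.exists_eq_succ_of_ne_zero (by
      intro h0
      rw [List.length_eq_zero_iff] at h0
      simp [h0] at h)
  obtain ⟨k, hk, hki⟩ := List.getElem_of_mem h
  have hk' : k < m + 1 := hm ▸ hk
  refine ⟨(TensorAlgebra.ι ℂ).comp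
    ((DirectSum.lof ℂ ℕ (fun n => PiTensorProduct ℂ (fun _ : Fin (n + 1) => A)) m).comp
      ((PiTensorProduct.tprod ℂ).toLinearMap (fun j => a (l.get (j.cast hm.symm))) ⟨k, hk'⟩)),
    fun x => ?_⟩
  rw [word_eq_of_length (n := m) _ (by simpa using hm)]
  simp only [LinearMap.comp_apply, pureWord, MultilinearMap.toLinearMap_apply]
  congr 4
  funext j
  by_cases hj : j = ⟨k, hk'⟩
  · subst hj
    simp [hki]
  · rw [Function.update_of_ne hj]
    simp only [List.get_eq_getElem, List.getElem_map, Fin.val_cast]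
    rw [Function.update_of_ne]
    intro hji
    apply hj
    apply Fin.ext
    exact (List.Nodup.getElem_inj_iff hl).1 (hji.trans hki.symm)

theorem barWord_update_of_notMem {n : ℕ} (L : List (List (Fin n)))
    (a : Fin n → A) (i : Fin n) (x : A) (h : i ∉ L.flatten) :
    barWord L (Function.update a i x) = barWord L a := by
  unfold barWord
  congr 1
  apply List.map_congr_left
  intro J hJ
  rw [map_update_of_notMem]
  intro hi
  exact h (List.mem_flatten.2 ⟨J, hJ, hi⟩)

theorem exists_linear_barWord {n : ℕ} (L : List (List (Fin n)))
    (hL : L.flatten.Nodup) (a : Fin n → A) (i : Fin n) (h : i ∈ L.flatten) :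
    ∃ f : A →ₗ[ℂ] DoubleTensor A, ∀ x, barWord L (Function.update a i x) = f x := by
  induction L with
  | nil => simp at h
  | cons J L ih =>
    rw [List.flatten_cons, List.nodup_append'] at hL
    obtain ⟨hJ, hL', hd⟩ := hL
    have key : ∀ x, barWord (J :: L) (Function.update a i x)
        = word (J.map (Function.update a i x)) * barWord L (Function.update a i x) := by
      intro x
      simp [barWord]
    by_cases hi : i ∈ J
    · obtain ⟨f, hf⟩ := exists_linear_word J hJ a i hi
      have hn : i ∉ L.flatten := fun h' => hd hi h'
      refine ⟨(LinearMap.mulRight ℂ (barWord L a)).comp f, fun x => ?_⟩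
      rw [key, hf, barWord_update_of_notMem L a i x hn]
      rfl
    · have hi' : i ∈ L.flatten := by
        rw [List.flatten_cons, List.mem_append] at h
        exact h.resolve_left hi
      obtain ⟨f, hf⟩ := ih hL' hi'
      refine ⟨(LinearMap.mulLeft ℂ (word (J.map a))).comp f, fun x => ?_⟩
      rw [key, hf, map_update_of_notMem J a i x hi]
      rfl

theorem flatten_intervals {n : ℕ} (l : List (Fin n)) : (intervals l).flatten = l :=
  List.flatten_splitBy _ l

theorem nodup_positions {n : ℕ} (S : Finset (Fin n)) : (positions S).Nodup :=
  (List.nodup_finRange n).filter _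

theorem mem_positions {n : ℕ} (S : Finset (Fin n)) (i : Fin n) : i ∈ positions S ↔ i ∈ S := by
  simp [positions]

/-- The summand `a_S ⊗ a_{J₁} | ⋯ | a_{J_k}` of the coproduct, `J₁, …, J_k` being the interval
components of the complement of `S`. -/
def coproductTermFun {n : ℕ} (S : Finset (Fin n)) (a : Fin n → A) :
    DoubleTensor A ⊗[ℂ] DoubleTensor A :=
  word ((positions S).map a) ⊗ₜ[ℂ] barWord (intervals (positions Sᶜ)) a

theorem exists_linear_coproductTermFun {n : ℕ} (S : Finset (Fin n))
    (a : Fin n → A) (i : Fin n) :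
    ∃ f : A →ₗ[ℂ] DoubleTensor A ⊗[ℂ] DoubleTensor A,
      ∀ x, coproductTermFun S (Function.update a i x) = f x := by
  by_cases hi : i ∈ S
  · obtain ⟨f, hf⟩ := exists_linear_word (positions S) (nodup_positions S) a i
      ((mem_positions S i).2 hi)
    have hn : i ∉ (intervals (positions Sᶜ)).flatten := by
      rw [flatten_intervals, mem_positions]
      simpa using hi
    refine ⟨((TensorProduct.mk ℂ _ _).flip (barWord (intervals (positions Sᶜ)) a)).comp f,
      fun x => ?_⟩
    simp only [coproductTermFun]
    rw [hf, barWord_update_of_notMem _ a i x hn]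
    rfl
  · have hi' : i ∈ (intervals (positions Sᶜ)).flatten := by
      rw [flatten_intervals, mem_positions]
      simpa using hi
    obtain ⟨f, hf⟩ := exists_linear_barWord (intervals (positions Sᶜ))
      (by rw [flatten_intervals]; exact nodup_positions _) a i hi'
    have hn : i ∉ positions S := fun h => hi ((mem_positions S i).1 h)
    refine ⟨(TensorProduct.mk ℂ _ _ (word ((positions S).map a))).comp f, fun x => ?_⟩
    simp only [coproductTermFun]
    rw [hf, map_update_of_notMem _ a i x hn]
    rfl

/-- `coproductTermFun` as a multilinear map of the letters. -/
def coproductTerm {n : ℕ} (S : Finset (Fin n)) :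
    MultilinearMap ℂ (fun _ : Fin n => A) (DoubleTensor A ⊗[ℂ] DoubleTensor A) :=
  MultilinearMap.mk' (coproductTermFun S)
    (fun a i x y => by
      obtain ⟨f, hf⟩ := exists_linear_coproductTermFun S a i
      rw [hf, hf, hf, map_add])
    (fun a i c x => by
      obtain ⟨f, hf⟩ := exists_linear_coproductTermFun S a i
      rw [hf, hf, map_smul])

/-- `∑ a_S ⊗ a_{J₁} | ⋯ | a_{J_k}`, the sum over the `S ⊆ [n]` in the family `F n`,
as a linear map on `T₊(A)`. -/
def wordCoproduct (F : ∀ n : ℕ, Finset (Finset (Fin (n + 1)))) :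
    Words A →ₗ[ℂ] DoubleTensor A ⊗[ℂ] DoubleTensor A :=
  DirectSum.toModule ℂ ℕ _ (fun n => PiTensorProduct.lift (∑ S ∈ F n, coproductTerm S))

/-- `Δ` on words: all subsets `S`. -/
def wordDelta : Words A →ₗ[ℂ] DoubleTensor A ⊗[ℂ] DoubleTensor A :=
  wordCoproduct (fun _ => Finset.univ)

/-- `Δ_≺` on words: the subsets `S` that contain the first position. -/
def wordDeltaPrec : Words A →ₗ[ℂ] DoubleTensor A ⊗[ℂ] DoubleTensor A :=
  wordCoproduct (fun _ => Finset.univ.filter (fun S => 0 ∈ S))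

/-- `Δ_≻` on words: the subsets `S` that do not contain the first position. -/
def wordDeltaSucc : Words A →ₗ[ℂ] DoubleTensor A ⊗[ℂ] DoubleTensor A :=
  wordCoproduct (fun _ => Finset.univ.filter (fun S => 0 ∉ S))

theorem wordCoproduct_pureWord (F : ∀ n : ℕ, Finset (Finset (Fin (n + 1)))) (n : ℕ)
    (a : Fin (n + 1) → A) :
    wordCoproduct (A := A) F (pureWord n a) = ∑ S ∈ F n, coproductTermFun S a := by
  simp [wordCoproduct, pureWord, coproductTerm]

/-- The coproduct `Δ : H → H ⊗ H`, the multiplicative extension of its values on words. -/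
def delta : DoubleTensor A →ₐ[ℂ] DoubleTensor A ⊗[ℂ] DoubleTensor A :=
  TensorAlgebra.lift ℂ wordDelta

/-- The matrices `!![0, d w; 0, Δ w]`, used to extend a half-coproduct from words to `H`. -/
def halfMatrix (d : Words A →ₗ[ℂ] DoubleTensor A ⊗[ℂ] DoubleTensor A) :
    Words A →ₗ[ℂ] Matrix (Fin 2) (Fin 2) (DoubleTensor A ⊗[ℂ] DoubleTensor A) where
  toFun w := !![0, d w; 0, wordDelta (A := A) w]
  map_add' v w := by ext i j; fin_cases i <;> fin_cases j <;> simp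
  map_smul' c w := by ext i j; fin_cases i <;> fin_cases j <;> simp

/-- The extension `D` to `H` of a map `d` on words with `D (w | u) = d w * Δ u` for a word `w` and
`u ∈ H`, and `D 𝟏 = 0` (see `halfExtend_one` and `halfExtend_ι_mul`). -/
def halfExtend (d : Words A →ₗ[ℂ] DoubleTensor A ⊗[ℂ] DoubleTensor A) :
    DoubleTensor A →ₗ[ℂ] DoubleTensor A ⊗[ℂ] DoubleTensor A where
  toFun u := TensorAlgebra.lift ℂ (halfMatrix d) u 0 1
  map_add' u v := by simp
  map_smul' c u := by simp

theorem halfExtend_one (d : Words A →ₗ[ℂ] DoubleTensor A ⊗[ℂ] DoubleTensor A) :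
    halfExtend d 1 = 0 := by
  simp [halfExtend]

theorem lift_halfMatrix_one_one (d : Words A →ₗ[ℂ] DoubleTensor A ⊗[ℂ] DoubleTensor A)
    (u : DoubleTensor A) :
    TensorAlgebra.lift ℂ (halfMatrix d) u 1 0 = 0 ∧
      TensorAlgebra.lift ℂ (halfMatrix d) u 1 1 = delta u := by
  induction u using TensorAlgebra.induction with
  | algebraMap r => simp [Matrix.algebraMap_matrix_apply]
  | ι x => simp [halfMatrix, delta]
  | mul a b ha hb => simp [Matrix.mul_apply, Fin.sum_univ_two, ha.1, ha.2, hb.1, hb.2]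
  | add a b ha hb => simp [ha.1, ha.2, hb.1, hb.2]

theorem halfExtend_ι_mul (d : Words A →ₗ[ℂ] DoubleTensor A ⊗[ℂ] DoubleTensor A)
    (w : Words A) (u : DoubleTensor A) :
    halfExtend d (TensorAlgebra.ι ℂ w * u) = d w * delta u := by
  have h := (lift_halfMatrix_one_one d u).2
  have h₀ : halfMatrix d w 0 0 = 0 := by simp [halfMatrix]
  have h₁ : halfMatrix d w 0 1 = d w := by simp [halfMatrix]
  simp [halfExtend, Matrix.mul_apply, Fin.sum_univ_two, h, h₀, h₁]

/-- The half-coproduct `Δ_≺`. -/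
def deltaPrec : DoubleTensor A →ₗ[ℂ] DoubleTensor A ⊗[ℂ] DoubleTensor A :=
  halfExtend wordDeltaPrec

/-- The half-coproduct `Δ_≻`. -/
def deltaSucc : DoubleTensor A →ₗ[ℂ] DoubleTensor A ⊗[ℂ] DoubleTensor A :=
  halfExtend wordDeltaSucc

/-- `Δ = Δ_≺ + Δ_≻` on the augmentation ideal. -/
theorem delta_eq_add (w : Words A) (u : DoubleTensor A) :
    delta (TensorAlgebra.ι ℂ w * u) =
      deltaPrec (TensorAlgebra.ι ℂ w * u) + deltaSucc (TensorAlgebra.ι ℂ w * u) := by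
  have h : (wordDelta : Words A →ₗ[ℂ] _) = wordDeltaPrec + wordDeltaSucc := by
    apply DirectSum.linearMap_ext
    intro n
    ext a
    simp [wordDelta, wordDeltaPrec, wordDeltaSucc, wordCoproduct,
      Finset.sum_filter_add_sum_filter_not]
  rw [deltaPrec, deltaSucc, halfExtend_ι_mul, halfExtend_ι_mul, ← add_mul, map_mul]
  congr 1
  simp [delta, h]

/-! ### The shuffle algebra `Hom(H, R)` -/

section Hom

variable {R : Type*} [CommRing R] [Algebra ℂ R]

/-- The counit `H → ℂ`; its kernel is the augmentation ideal `H₊`. -/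
def counit : DoubleTensor A →ₐ[ℂ] ℂ := TensorAlgebra.algebraMapInv

/-- The unit `ε` of `Hom(H, R)`: `ε(𝟏) = 1` and `ε = 0` on `H₊`. -/
def eps : DoubleTensor A →ₗ[ℂ] R :=
  (Algebra.linearMap ℂ R).comp (counit (A := A)).toLinearMap

/-- `m_R ∘ (f ⊗ g) ∘ D`. -/
def convolve (D : DoubleTensor A →ₗ[ℂ] DoubleTensor A ⊗[ℂ] DoubleTensor A)
    (f g : DoubleTensor A →ₗ[ℂ] R) : DoubleTensor A →ₗ[ℂ] R :=
  (LinearMap.mul' ℂ R).comp ((TensorProduct.map f g).comp D)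

/-- The convolution product `f ⋆ g`. -/
def starMul (f g : DoubleTensor A →ₗ[ℂ] R) : DoubleTensor A →ₗ[ℂ] R :=
  convolve delta.toLinearMap f g

/-- The half-shuffle product `f ≺ g`. -/
def precMul (f g : DoubleTensor A →ₗ[ℂ] R) : DoubleTensor A →ₗ[ℂ] R :=
  convolve deltaPrec f g

/-- The half-shuffle product `f ≻ g`. -/
def succMul (f g : DoubleTensor A →ₗ[ℂ] R) : DoubleTensor A →ₗ[ℂ] R :=
  convolve deltaSucc f g

/-- Infinitesimal characters: they vanish at `𝟏` and on products of elements of `H₊`. -/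
def IsInfinitesimalCharacter (f : DoubleTensor A →ₗ[ℂ] R) : Prop :=
  f 1 = 0 ∧ ∀ u v : DoubleTensor A, counit u = 0 → counit v = 0 → f (u * v) = 0

/-- `g` is a two-sided inverse of `f` for the convolution product. -/
def IsConvInverse (f g : DoubleTensor A →ₗ[ℂ] R) : Prop :=
  starMul f g = eps ∧ starMul g f = eps

open Classical in
/-- The convolution inverse `f⁻¹` (`0` if there is none). -/
def convInv (f : DoubleTensor A →ₗ[ℂ] R) : DoubleTensor A →ₗ[ℂ] R :=
  if h : ∃ g, IsConvInverse f g then h.choose else 0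

/-- The shuffle adjoint action `θ_Ψ(α) = Ψ⁻¹ ≻ α ≺ Ψ`. -/
def shuffleAdjoint (Ψ α : DoubleTensor A →ₗ[ℂ] R) : DoubleTensor A →ₗ[ℂ] R :=
  precMul (succMul (convInv Ψ) α) Ψ

/-- A series of linear maps has, at each element of `H`, only finitely many non-zero terms. -/
def LocallyFiniteSeries (t : ℕ → DoubleTensor A →ₗ[ℂ] R) : Prop :=
  ∀ u, {n | t n u ≠ 0}.Finite

open Classical in
/-- The pointwise sum of a locally finite series of linear maps (`0` if it is not locally
finite). -/
def seriesSum (t : ℕ → DoubleTensor A →ₗ[ℂ] R) : DoubleTensor A →ₗ[ℂ] R :=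
  if h : LocallyFiniteSeries t then
    { toFun := fun u => ∑ᶠ n, t n u
      map_add' := fun u v => by
        simp only [map_add]
        exact finsum_add_distrib (h u) (h v)
      map_smul' := fun c u => by
        simp only [map_smul, RingHom.id_apply]
        exact (smul_finsum' c (h u)).symm }
  else 0

/-- Convolution powers `f^{⋆ n}`. -/
def convPow (f : DoubleTensor A →ₗ[ℂ] R) : ℕ → DoubleTensor A →ₗ[ℂ] R
  | 0 => eps
  | n + 1 => starMul f (convPow f n)

/-- The terms `f^{⋆ n} / n!` of the convolution exponential. -/
def expTerm (f : DoubleTensor A →ₗ[ℂ] R) (n : ℕ) : DoubleTensor A →ₗ[ℂ] R :=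
  ((n.factorial : ℂ)⁻¹) • convPow f n

/-- The convolution exponential `exp^⋆(f) = ∑_{n ≥ 0} f^{⋆ n} / n!`. -/
def convExp (f : DoubleTensor A →ₗ[ℂ] R) : DoubleTensor A →ₗ[ℂ] R :=
  seriesSum (expTerm f)

/-- `ad_f(g) = [f, g] = f ⋆ g - g ⋆ f`. -/
def adBracket (f g : DoubleTensor A →ₗ[ℂ] R) : DoubleTensor A →ₗ[ℂ] R :=
  starMul f g - starMul g f

/-- The terms `(-1)^n / (n+1)! ad_f^n(g)` of `W_f(g)`. -/
def wTerm (f g : DoubleTensor A →ₗ[ℂ] R) (n : ℕ) : DoubleTensor A →ₗ[ℂ] R :=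
  ((-1 : ℂ) ^ n / ((n + 1).factorial : ℂ)) • (adBracket f)^[n] g

/-- `W_f(g) = (e^{-ad_f} - 1) / (-ad_f) (g) = ∑_{n ≥ 0} (-1)^n / (n+1)! ad_f^n(g)`. -/
def wMap (f g : DoubleTensor A →ₗ[ℂ] R) : DoubleTensor A →ₗ[ℂ] R :=
  seriesSum (wTerm f g)

/-- The algebra homomorphism `H → R` with value `ψ(a₁ ⋯ aₙ)` (product in `A`) at the word
`a₁ ⊗ ⋯ ⊗ aₙ`. -/
def momentExtension (ψ : A →ₗ[ℂ] R) : DoubleTensor A →ₐ[ℂ] R :=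
  TensorAlgebra.lift ℂ (DirectSum.toModule ℂ ℕ _ (fun n =>
    PiTensorProduct.lift (ψ.compMultilinearMap (MultilinearMap.mkPiAlgebraFin ℂ (n + 1) A))))

end Hom

/-! ### Grassmann-valued functionals

The Grassmann algebra `𝔾 = {z + ħ w}`, `ħ² = 0`, is `DualNumber ℂ`. -/

/-- `f + ħ f'`. -/
def grassmann {V : Type*} [AddCommGroup V] [Module ℂ V] (f f' : V →ₗ[ℂ] ℂ) :
    V →ₗ[ℂ] DualNumber ℂ :=
  (TrivSqZeroExt.inlAlgHom ℂ ℂ ℂ).toLinearMap.comp f + (TrivSqZeroExt.inrHom ℂ ℂ).comp f'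

/-- The character `Φ : H → ℂ` extending the moments of `φ`. -/
def moment (φ : A →ₗ[ℂ] ℂ) : DoubleTensor A →ₗ[ℂ] ℂ :=
  (momentExtension φ).toLinearMap

/-- The character `Φ̃ : H → 𝔾` extending the moments of `φ + ħ φ'`. -/
def grassmannMoment (φ φ' : A →ₗ[ℂ] ℂ) : DoubleTensor A →ₗ[ℂ] DualNumber ℂ :=
  (momentExtension (grassmann φ φ')).toLinearMap

/-- The infinitesimal moment functional `Φ'`, the `ħ`-coefficient of `Φ̃`: it extends the moments
of `φ'` by the Leibniz rule `Φ'(u | v) = Φ(u) Φ'(v) + Φ'(u) Φ(v)`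
(see `infMoment_pureWord`, `infMoment_mul`). -/
def infMoment (φ φ' : A →ₗ[ℂ] ℂ) : DoubleTensor A →ₗ[ℂ] ℂ :=
  (TrivSqZeroExt.sndHom ℂ ℂ).comp (grassmannMoment φ φ')

theorem momentExtension_pureWord {R : Type*} [CommRing R] [Algebra ℂ R] (ψ : A →ₗ[ℂ] R) (n : ℕ)
    (a : Fin (n + 1) → A) :
    momentExtension ψ (TensorAlgebra.ι ℂ (pureWord n a)) = ψ (List.ofFn a).prod := by
  simp [momentExtension, pureWord]

theorem grassmannMoment_eq (φ φ' : A →ₗ[ℂ] ℂ) :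
    grassmannMoment φ φ' = grassmann (moment φ) (infMoment φ φ') := by
  have h : (TrivSqZeroExt.fstHom ℂ ℂ ℂ).comp (momentExtension (grassmann φ φ'))
      = momentExtension φ := by
    apply TensorAlgebra.hom_ext
    apply DirectSum.linearMap_ext
    intro n
    ext a
    simp [momentExtension, grassmann]
  apply LinearMap.ext
  intro u
  have hu := DFunLike.congr_fun h u
  apply TrivSqZeroExt.ext
  · simpa [grassmannMoment, grassmann, moment, infMoment] using hu
  · simp [grassmannMoment, grassmann, moment, infMoment]

theorem infMoment_pureWord (φ φ' : A →ₗ[ℂ] ℂ) (n : ℕ) (a : Fin (n + 1) → A) :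
    infMoment φ φ' (TensorAlgebra.ι ℂ (pureWord n a)) = φ' (List.ofFn a).prod := by
  simp [infMoment, grassmannMoment, momentExtension_pureWord, grassmann]

theorem infMoment_mul (φ φ' : A →ₗ[ℂ] ℂ) (u v : DoubleTensor A) :
    infMoment φ φ' (u * v) = moment φ u * infMoment φ φ' v + infMoment φ φ' u * moment φ v := by
  have h : ∀ x, TrivSqZeroExt.fst (grassmannMoment φ φ' x) = moment φ x := by
    intro x
    rw [grassmannMoment_eq]
    simp [grassmann]
  simp only [infMoment, LinearMap.comp_apply, ← h]
  simp [grassmannMoment]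

end ShuffleCumulant

end

noncomputable section

namespace ShuffleCumulant

variable {A : Type*} [Ring A] [Algebra ℂ A]

/-! ### A recursive description of the coproduct -/

/-! Both iterated coproducts of a word distribute its letters over three tensor factors, by the rule
recorded in `tripleScan`. This gives coassociativity of `delta`. Fixing the factor that receives the
first letter gives the three relations for the half-coproducts. Dually, `Hom(H, R)` is a shuffle
(dendriform) algebra: `(f ≺ g) ≺ h = f ≺ (g ⋆ h)`, `(f ≻ g) ≺ h = f ≻ (g ≺ h)`, `(f ⋆ g) ≻ h = f ≻
(g ≻ h)`. The work lies in `tensorLeft_wordScan_mul` and `tensorRight_wordScan_mul`.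

All three coproducts preserve the number of letters, so the products add orders of vanishing
(`convolve_mem_vanishing`), and a functional vanishing to every order is zero. Multiplication by a
functional that is zero at `𝟏` therefore raises the order. This yields convolution inverses by a
Neumann series, local finiteness of the series in play, and uniqueness for linear fixed-point
equations.

The `ħ`-coefficient of the free equation is `Φ' = κ' ≺ Φ + κ ≺ Φ'`. By the shuffle relations `Φ ⋆
θ_Φ(κ')` solves the same equation, hence equals `Φ'` (`eq_starMul_shuffleAdjoint`); the Boolean case
is its mirror image (`eq_shuffleAdjoint_starMul`). In the monotone case `Φ'` is the derivative of
`exp^⋆` at `ρ` in direction `ρ'`. With `L`, `R` the multiplications by `ρ` on the left and right,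
the `n`-th power contributes `∑ L^k R^(n-1-k) ρ'`, and expanding in `L` and `R - L = -ad_ρ` makes
the series the Cauchy product of `exp^⋆(ρ)` and `W_ρ(ρ')` (`inv_factorial_smul_convPowDeriv`,
`eq_starMul_wMap`). -/

/-- The sum over the ways of sending the letters of a word either to the left (appended to `t`)
or to the right (appended to the open interval `u`, which is closed, contributing the factor
`p u`, when a letter is sent to the left). -/
def scan {B M : Type*} [Semiring M] (p : List B → M) (f : List B → List B → M) :
    List B → List B → List B → M
  | t, u, [] => f t u
  | t, u, a :: s => p u * scan p f (t ++ [a]) [] s + scan p f t (u ++ [a]) s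

/-- The coproduct of a word, started from the left word `t` and the open interval `u`. -/
def wordScan (t u s : List A) : DoubleTensor A ⊗[ℂ] DoubleTensor A :=
  scan (fun v => 1 ⊗ₜ word v) (fun x y => word x ⊗ₜ word y) t u s

theorem wordScan_nil (t u : List A) : wordScan t u [] = word t ⊗ₜ word u := rfl

theorem wordScan_cons (t u : List A) (a : A) (s : List A) :
    wordScan t u (a :: s) =
      (1 ⊗ₜ word u) * wordScan (t ++ [a]) [] s + wordScan t (u ++ [a]) s := rfl

/-- The product of the words on the maximal runs of letters outside `S`, `u` being the run that
is open at the start. -/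
def runProd {n : ℕ} (a : Fin n → A) (S : Finset (Fin n)) : List A → List (Fin n) → DoubleTensor A
  | u, [] => word u
  | u, i :: l => if i ∈ S then word u * runProd a S [] l else runProd a S (u ++ [a i]) l

theorem runProd_insert {n : ℕ} (a : Fin n → A) (S : Finset (Fin n)) (i : Fin n) (u : List A)
    (l : List (Fin n)) (h : i ∉ l) : runProd a (insert i S) u l = runProd a S u l := by
  induction l generalizing u with
  | nil => rfl
  | cons j l ih =>
    rw [List.mem_cons, not_or] at h
    have : j ≠ i := fun e => h.1 e.symm
    simp [runProd, ih _ h.2, this]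

/-- Splitting the subsets by whether they contain the head of `l` reproduces the two branches of
`scan`. The accumulators `t`, `u` stay general because each branch changes one of them. Since `word
[] = 1`, closing an empty interval costs nothing. -/
theorem sum_powerset_eq_wordScan {n : ℕ} (a : Fin n → A) (l : List (Fin n)) (hl : l.Nodup)
    (t u : List A) :
    ∑ S ∈ l.toFinset.powerset,
      word (t ++ (l.filter (fun i => decide (i ∈ S))).map a) ⊗ₜ[ℂ] runProd a S u l =
      wordScan t u (l.map a) := by
  induction l generalizing t u with
  | nil => simp [runProd, wordScan_nil]
  | cons i l ih =>
    rw [List.nodup_cons] at hl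
    have hi : i ∉ l.toFinset := by simpa using hl.1
    rw [List.toFinset_cons, Finset.sum_powerset_insert hi, List.map_cons, wordScan_cons, add_comm,
      ← ih hl.2, ← ih hl.2, Finset.mul_sum]
    congr 1
    · refine Finset.sum_congr rfl fun S _ => ?_
      have hf : l.filter (fun j => decide (j ∈ insert i S)) =
          l.filter (fun j => decide (j ∈ S)) := by
        refine List.filter_congr fun j hj => ?_
        have : j ≠ i := fun e => hl.1 (e ▸ hj)
        simp [this]
      simp only [List.filter_cons, Finset.mem_insert_self, decide_true, if_true, hf, List.map_cons,
        runProd, runProd_insert a S i _ l hl.1, Algebra.TensorProduct.tmul_mul_tmul, one_mul,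
        List.append_assoc, List.cons_append, List.nil_append]
    · refine Finset.sum_congr rfl fun S hS => ?_
      have : i ∉ S := fun h => hi (Finset.mem_powerset.1 hS h)
      simp [runProd, this]

theorem barWord_cons {n : ℕ} (J : List (Fin n)) (L : List (List (Fin n))) (a : Fin n → A) :
    barWord (J :: L) a = word (J.map a) * barWord L a := by
  simp [barWord]

theorem barWord_append {n : ℕ} (L L' : List (List (Fin n))) (a : Fin n → A) :
    barWord (L ++ L') a = barWord L a * barWord L' a := by
  simp [barWord]

/-- `splitBy` closes an interval only on meeting the next element, whereas `runProd` closes it at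
the first position in `S`. The two clauses are the two states: the run ending at `k` may still grow,
or a gap has occurred that the loop has not yet seen. Each state can lead to the other, hence the
joint induction. -/
theorem barWord_splitBy_loop {n : ℕ} (a : Fin n → A) (S : Finset (Fin n)) (l : List (Fin n)) :
    (∀ (k : Fin n) (g : List (Fin n)) (gs : List (List (Fin n))),
      (k :: l).IsChain (fun i j => i.val + 1 = j.val) →
      barWord (List.splitBy.loop (fun i j => decide (i.val + 1 = j.val))
        (l.filter (fun i => decide (i ∈ Sᶜ))) k g gs) a =
      barWord gs.reverse a * runProd a S ((k :: g).reverse.map a) l) ∧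
    (∀ (k : Fin n) (g : List (Fin n)) (gs : List (List (Fin n))),
      l.IsChain (fun i j => i.val + 1 = j.val) → (∀ x ∈ l, k.val + 1 < x.val) →
      barWord (List.splitBy.loop (fun i j => decide (i.val + 1 = j.val))
        (l.filter (fun i => decide (i ∈ Sᶜ))) k g gs) a =
      barWord gs.reverse a * (word ((k :: g).reverse.map a) * runProd a S [] l)) := by
  induction l with
  | nil =>
    refine ⟨fun k g gs _ => ?_, fun k g gs _ _ => ?_⟩ <;>
    simp [List.splitBy.loop, runProd, barWord, word]
  | cons x l ih =>
    refine ⟨fun k g gs hc => ?_, fun k g gs hc hk => ?_⟩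
    · rw [List.isChain_cons_cons] at hc
      by_cases hx : x ∈ S
      -- The position `k + 1 = x` is skipped, so no later position is adjacent to `k` and the loop
      -- is bound to cut.
      · have hlt : ∀ y ∈ l, k.val + 1 < y.val := by
          have h2 : (x :: l).IsChain (fun i j => i.val < j.val) :=
            hc.2.imp (fun _ _ h => by omega)
          rw [List.isChain_iff_pairwise] at h2
          intro y hy
          have := List.rel_of_pairwise_cons h2 hy
          omega
        simp only [List.filter_cons, Finset.mem_compl, hx, not_true_eq_false, decide_false,
          Bool.false_eq_true, if_false, runProd, if_true]
        simpa using ih.2 k g gs hc.2.tail hlt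
      · simp only [List.filter_cons, Finset.mem_compl, hx, not_false_eq_true, decide_true,
          if_true, runProd, if_false, List.splitBy.loop, hc.1]
        simpa using ih.1 x (k :: g) gs hc.2
    · by_cases hx : x ∈ S
      · simp only [List.filter_cons, Finset.mem_compl, hx, not_true_eq_false, decide_false,
          Bool.false_eq_true, if_false, runProd, if_true]
        simpa [word] using ih.2 k g gs hc.tail (fun y hy => hk y (List.mem_cons_of_mem _ hy))
      · have hne : ¬ (k.val + 1 = x.val) := by
          have := hk x List.mem_cons_self
          omega
        simp only [List.filter_cons, Finset.mem_compl, hx, not_false_eq_true, decide_true,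
          if_true, runProd, if_false, List.splitBy.loop, hne, decide_false]
        simpa [barWord_append, barWord_cons, barWord, mul_assoc] using
          ih.1 x [] ((k :: g).reverse :: gs) hc

theorem barWord_intervals_filter {n : ℕ} (a : Fin n → A) (S : Finset (Fin n)) (l : List (Fin n))
    (hl : l.IsChain (fun i j => i.val + 1 = j.val)) :
    barWord (intervals (l.filter (fun i => decide (i ∈ Sᶜ)))) a = runProd a S [] l := by
  induction l with
  | nil => simp [intervals, barWord, runProd, word]
  | cons x l ih =>
    by_cases hx : x ∈ S
    · simpa [List.filter_cons, hx, runProd, word] using ih hl.tail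
    · have := (barWord_splitBy_loop a S l).1 x [] [] hl
      simpa [List.filter_cons, hx, runProd, intervals, List.splitBy, barWord] using this

theorem isChain_finRange (n : ℕ) :
    (List.finRange n).IsChain (fun i j => i.val + 1 = j.val) := by
  rw [List.isChain_iff_getElem]
  intro i hi
  simp

theorem coproductTermFun_eq {n : ℕ} (S : Finset (Fin n)) (a : Fin n → A) :
    coproductTermFun S a =
      word (((List.finRange n).filter (fun i => decide (i ∈ S))).map a) ⊗ₜ[ℂ]
        runProd a S [] (List.finRange n) := by
  rw [coproductTermFun, positions, positions, barWord_intervals_filter a S _ (isChain_finRange n)]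

theorem univ_eq_powerset_finRange (n : ℕ) :
    (Finset.univ : Finset (Finset (Fin n))) = (List.finRange n).toFinset.powerset := by
  simp

theorem word_map_finRange {n : ℕ} (a : Fin (n + 1) → A) :
    word ((List.finRange (n + 1)).map a) = TensorAlgebra.ι ℂ (pureWord n a) := by
  rw [word_eq_of_length (n := n) _ (by simp)]
  congr 2
  funext i
  simp

theorem word_cons_eq (a : A) (l : List A) :
    word (a :: l) = TensorAlgebra.ι ℂ (pureWord l.length (fun i => (a :: l).get i)) := rfl

theorem map_get_finRange {B : Type*} (l : List B) : (List.finRange l.length).map l.get = l := by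
  simp

theorem wordDelta_pureWord (a : A) (l : List A) :
    wordDelta (A := A) (pureWord l.length (fun i => (a :: l).get i)) = wordScan [] [] (a :: l) := by
  rw [wordDelta, wordCoproduct_pureWord, univ_eq_powerset_finRange]
  have h := sum_powerset_eq_wordScan (fun i => (a :: l).get i) (List.finRange (l.length + 1))
    (List.nodup_finRange _) [] []
  have e : (List.finRange (l.length + 1)).map (fun i => (a :: l).get i) = a :: l :=
    map_get_finRange (a :: l)
  rw [e] at h
  rw [← h]
  exact Finset.sum_congr rfl fun S _ => coproductTermFun_eq S _

/-- Restricting to `0 ∈ S` or `0 ∉ S` leaves an arbitrary subset of the remaining positions, with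
the first letter already placed in the left word or in the open interval. -/
theorem wordDeltaHalf_pureWord (a : A) (l : List A) :
    wordDeltaPrec (A := A) (pureWord l.length (fun i => (a :: l).get i)) = wordScan [a] [] l ∧
    wordDeltaSucc (A := A) (pureWord l.length (fun i => (a :: l).get i)) = wordScan [] [a] l := by
  set b : Fin (l.length + 1) → A := fun i => (a :: l).get i with hb
  set l' : List (Fin (l.length + 1)) := (List.finRange l.length).map Fin.succ with hl'
  have hr : List.finRange (l.length + 1) = 0 :: l' := List.finRange_succ
  have hnd : (0 :: l').Nodup := hr ▸ List.nodup_finRange _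
  have h0 : (0 : Fin (l.length + 1)) ∉ l' := (List.nodup_cons.1 hnd).1
  have h0' : (0 : Fin (l.length + 1)) ∉ l'.toFinset := by simpa using h0
  have hm : l'.map b = l := by
    rw [hl', List.map_map]
    exact map_get_finRange l
  have hp := sum_powerset_eq_wordScan b l' (List.nodup_cons.1 hnd).2 [a] []
  have hs := sum_powerset_eq_wordScan b l' (List.nodup_cons.1 hnd).2 [] [a]
  rw [hm] at hp hs
  rw [← hp, ← hs]
  constructor
  · rw [wordDeltaPrec, wordCoproduct_pureWord, Finset.sum_filter, univ_eq_powerset_finRange, hr,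
      List.toFinset_cons, Finset.sum_powerset_insert h0', Finset.sum_eq_zero, zero_add]
    · refine Finset.sum_congr rfl fun S _ => ?_
      have hf : l'.filter (fun j => decide (j ∈ insert 0 S)) =
          l'.filter (fun j => decide (j ∈ S)) := by
        refine List.filter_congr fun j hj => ?_
        have : j ≠ 0 := fun e => h0 (e ▸ hj)
        simp [this]
      rw [if_pos (Finset.mem_insert_self _ _), coproductTermFun_eq, hr]
      simp only [List.filter_cons, Finset.mem_insert_self, decide_true, if_true, hf, List.map_cons,
        runProd, runProd_insert b S 0 _ l' h0]
      rw [show word ([] : List A) = 1 from rfl, one_mul]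
      rfl
    · intro S hS
      exact if_neg fun h => h0' (Finset.mem_powerset.1 hS h)
  · rw [wordDeltaSucc, wordCoproduct_pureWord, Finset.sum_filter, univ_eq_powerset_finRange, hr,
      List.toFinset_cons, Finset.sum_powerset_insert h0', add_comm, Finset.sum_eq_zero, zero_add]
    · refine Finset.sum_congr rfl fun S hS => ?_
      have hS0 : (0 : Fin (l.length + 1)) ∉ S := fun h => h0' (Finset.mem_powerset.1 hS h)
      rw [if_pos hS0, coproductTermFun_eq, hr]
      simp [runProd, hS0, hb]
    · intro S _
      simp

theorem delta_word (l : List A) : delta (word l) = wordScan [] [] l := by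
  cases l with
  | nil =>
    rw [wordScan_nil]
    simp [word, Algebra.TensorProduct.one_def]
  | cons a l => rw [word_cons_eq, delta, TensorAlgebra.lift_ι_apply, wordDelta_pureWord]

theorem deltaPrec_word_mul (a : A) (l : List A) (u : DoubleTensor A) :
    deltaPrec (word (a :: l) * u) = wordScan [a] [] l * delta u := by
  rw [word_cons_eq, deltaPrec, halfExtend_ι_mul, (wordDeltaHalf_pureWord a l).1]

theorem deltaSucc_word_mul (a : A) (l : List A) (u : DoubleTensor A) :
    deltaSucc (word (a :: l) * u) = wordScan [] [a] l * delta u := by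
  rw [word_cons_eq, deltaSucc, halfExtend_ι_mul, (wordDeltaHalf_pureWord a l).2]

/-! ### Coassociativity -/

/-- The last letter is absorbed into the terminal function. An iterated coproduct appends letters to
the inner word at its end, while `scan` consumes words from the front. -/
theorem scan_append_singleton {B M : Type*} [Semiring M] (p : List B → M)
    (f : List B → List B → M)
    (t u s : List B) (a : B) :
    scan p f t u (s ++ [a]) =
      scan p (fun t u => p u * f (t ++ [a]) [] + f t (u ++ [a])) t u s := by
  induction s generalizing t u with
  | nil => rfl
  | cons b s ih => simp only [List.cons_append, scan, ih]

theorem scan_add {B M : Type*} [Semiring M] (p : List B → M) (f g : List B → List B → M)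
    (t u s : List B) :
    scan p (fun t u => f t u + g t u) t u s = scan p f t u s + scan p g t u s := by
  induction s generalizing t u with
  | nil => rfl
  | cons b s ih => simp only [scan, ih, mul_add]; abel

theorem mul_scan {B M : Type*} [Semiring M] (p : List B → M) (f : List B → List B → M)
    (z : M)
    (hz : ∀ u, z * p u = p u * z) (t u s : List B) :
    z * scan p f t u s = scan p (fun t u => z * f t u) t u s := by
  induction s generalizing t u with
  | nil => rfl
  | cons b s ih => simp only [scan, mul_add, ← ih, ← mul_assoc, hz]

/-- `H ⊗ (H ⊗ H)`. -/
abbrev TripleTensor (A : Type*) [Ring A] [Algebra ℂ A] : Type _ :=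
  DoubleTensor A ⊗[ℂ] (DoubleTensor A ⊗[ℂ] DoubleTensor A)

/-- The words sent to the three tensor factors by the iterated coproduct, started from the left
word `t`, the open middle interval `u` and the open right interval `v`. -/
def tripleScan : List A → List A → List A → List A →
    TripleTensor A
  | t, u, v, [] => word t ⊗ₜ (word u ⊗ₜ word v)
  | t, u, v, a :: l =>
    (1 ⊗ₜ (word u ⊗ₜ word v)) * tripleScan (t ++ [a]) [] [] l +
      (1 ⊗ₜ (1 ⊗ₜ word v)) * tripleScan t (u ++ [a]) [] l + tripleScan t u (v ++ [a]) l

/-- `Q ⊗ id`, with values in `H ⊗ (H ⊗ H)`. -/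
def tensorLeft (Q : DoubleTensor A →ₗ[ℂ] DoubleTensor A ⊗[ℂ] DoubleTensor A) :
    DoubleTensor A ⊗[ℂ] DoubleTensor A →ₗ[ℂ] TripleTensor A :=
  (Algebra.TensorProduct.assoc ℂ ℂ ℂ (DoubleTensor A) (DoubleTensor A)
    (DoubleTensor A)).toLinearMap.comp (TensorProduct.map Q LinearMap.id)

/-- `id ⊗ Q`. -/
def tensorRight (Q : DoubleTensor A →ₗ[ℂ] DoubleTensor A ⊗[ℂ] DoubleTensor A) :
    DoubleTensor A ⊗[ℂ] DoubleTensor A →ₗ[ℂ] TripleTensor A :=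
  TensorProduct.map LinearMap.id Q

theorem tensorLeft_tmul (Q : DoubleTensor A →ₗ[ℂ] DoubleTensor A ⊗[ℂ] DoubleTensor A)
    (x y : DoubleTensor A) :
    tensorLeft Q (x ⊗ₜ y) = Algebra.TensorProduct.assoc ℂ ℂ ℂ (DoubleTensor A) (DoubleTensor A)
      (DoubleTensor A) (Q x ⊗ₜ y) := rfl

theorem tensorRight_tmul (Q : DoubleTensor A →ₗ[ℂ] DoubleTensor A ⊗[ℂ] DoubleTensor A)
    (x y : DoubleTensor A) : tensorRight Q (x ⊗ₜ y) = x ⊗ₜ Q y := rfl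

theorem tensorLeft_one_tmul_mul (Q : DoubleTensor A →ₗ[ℂ] DoubleTensor A ⊗[ℂ] DoubleTensor A)
    (x : DoubleTensor A) (y : DoubleTensor A ⊗[ℂ] DoubleTensor A) :
    tensorLeft Q ((1 ⊗ₜ x) * y) = (1 ⊗ₜ (1 ⊗ₜ x)) * tensorLeft Q y := by
  induction y using TensorProduct.induction_on with
  | zero => simp
  | add y z hy hz => simp only [mul_add, map_add, hy, hz]
  | tmul y z =>
    rw [Algebra.TensorProduct.tmul_mul_tmul, one_mul, tensorLeft_tmul, tensorLeft_tmul,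
      ← Algebra.TensorProduct.assoc_tmul (R := ℂ) (S := ℂ) (T := ℂ), ← map_mul,
      Algebra.TensorProduct.tmul_mul_tmul, ← Algebra.TensorProduct.one_def, one_mul]

theorem tensorLeft_tmul_mul (Q : DoubleTensor A →ₗ[ℂ] DoubleTensor A ⊗[ℂ] DoubleTensor A)
    (w x : DoubleTensor A) (X : DoubleTensor A ⊗[ℂ] DoubleTensor A)
    (hQ : ∀ y, Q (w * y) = X * delta y)
    (y : DoubleTensor A ⊗[ℂ] DoubleTensor A) :
    tensorLeft Q ((w ⊗ₜ x) * y) = Algebra.TensorProduct.assoc ℂ ℂ ℂ (DoubleTensor A)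
      (DoubleTensor A) (DoubleTensor A) (X ⊗ₜ x) * tensorLeft delta.toLinearMap y := by
  induction y using TensorProduct.induction_on with
  | zero => simp
  | add y z hy hz => simp only [mul_add, map_add, hy, hz]
  | tmul y z =>
    rw [Algebra.TensorProduct.tmul_mul_tmul, tensorLeft_tmul, tensorLeft_tmul, hQ, ← map_mul,
      Algebra.TensorProduct.tmul_mul_tmul]
    rfl

theorem tensorRight_tmul_mul (Q : DoubleTensor A →ₗ[ℂ] DoubleTensor A ⊗[ℂ] DoubleTensor A)
    (w x : DoubleTensor A) (X : DoubleTensor A ⊗[ℂ] DoubleTensor A)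
    (hQ : ∀ y, Q (w * y) = X * delta y)
    (y : DoubleTensor A ⊗[ℂ] DoubleTensor A) :
    tensorRight Q ((x ⊗ₜ w) * y) = (x ⊗ₜ X) * tensorRight delta.toLinearMap y := by
  induction y using TensorProduct.induction_on with
  | zero => simp
  | add y z hy hz => simp only [mul_add, map_add, hy, hz]
  | tmul y z =>
    rw [Algebra.TensorProduct.tmul_mul_tmul, tensorRight_tmul, tensorRight_tmul, hQ,
      Algebra.TensorProduct.tmul_mul_tmul]
    rfl

theorem assoc_wordScan_tmul (t u s : List A) (x : DoubleTensor A) :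
    Algebra.TensorProduct.assoc ℂ ℂ ℂ (DoubleTensor A) (DoubleTensor A) (DoubleTensor A)
      (wordScan t u s ⊗ₜ x) =
      scan (M := TripleTensor A) (fun v => 1 ⊗ₜ[ℂ] (word v ⊗ₜ[ℂ] 1)) (fun t u => word t ⊗ₜ[ℂ] (word u ⊗ₜ[ℂ] x)) t u s := by
  induction s generalizing t u with
  | nil => rfl
  | cons a s ih =>
    rw [wordScan_cons, TensorProduct.add_tmul, map_add, scan, ← ih, ← ih,
      ← Algebra.TensorProduct.assoc_tmul (R := ℂ) (S := ℂ) (T := ℂ), ← map_mul,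
      Algebra.TensorProduct.tmul_mul_tmul, one_mul]

theorem tmul_wordScan (w : DoubleTensor A) (u v s : List A) :
    w ⊗ₜ[ℂ] wordScan u v s =
      scan (M := TripleTensor A) (fun v => 1 ⊗ₜ[ℂ] (1 ⊗ₜ[ℂ] word v)) (fun u v => w ⊗ₜ[ℂ] (word u ⊗ₜ[ℂ] word v)) u v s := by
  induction s generalizing u v with
  | nil => rfl
  | cons a s ih =>
    rw [wordScan_cons, TensorProduct.tmul_add, scan, ← ih, ← ih,
      Algebra.TensorProduct.tmul_mul_tmul, one_mul]

theorem scan_mul {B M : Type*} [Semiring M] (p : List B → M) (f : List B → List B → M)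
    (z : M)
    (t u s : List B) :
    scan p f t u s * z = scan p (fun t u => f t u * z) t u s := by
  induction s generalizing t u with
  | nil => rfl
  | cons b s ih => simp only [scan, add_mul, ← ih, mul_assoc]

/-- The hypothesis `hQ` covers `delta`, `deltaPrec` and `deltaSucc` at once: `s₀` is the prefix
whose placement is prescribed, `t₀`, `u₀` its images. The inner scan runs over letters already sent
left by the outer one; `tripleScan` treats those still to come. The factor `y` carries the remaining
bar words. -/
theorem tensorLeft_wordScan_mul
    (Q : DoubleTensor A →ₗ[ℂ] DoubleTensor A ⊗[ℂ] DoubleTensor A) (s₀ t₀ u₀ : List A)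
    (hQ : ∀ s x, Q (word (s₀ ++ s) * x) = wordScan t₀ u₀ s * delta x)
    (y : DoubleTensor A ⊗[ℂ] DoubleTensor A) (l s v : List A) :
    tensorLeft Q (wordScan (s₀ ++ s) v l * y) =
      scan (M := TripleTensor A) (fun u => 1 ⊗ₜ[ℂ] (word u ⊗ₜ[ℂ] 1)) (fun t u => tripleScan t u v l) t₀ u₀ s *
        tensorLeft delta.toLinearMap y := by
  induction l generalizing s v with
  | nil =>
    rw [wordScan_nil, tensorLeft_tmul_mul Q _ _ _ (hQ s), assoc_wordScan_tmul]
    rfl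
  | cons a l ih =>
    rw [wordScan_cons, add_mul, map_add, mul_assoc, tensorLeft_one_tmul_mul, ih, List.append_assoc,
      ih, scan_append_singleton, ← mul_assoc, ← add_mul]
    congr 1
    -- The word of the closed right interval must move past the factors emitted by the inner scan.
    -- They commute because they occupy different tensor factors.
    rw [mul_scan, ← scan_add]
    · congr 1
      funext t u
      simp only [tripleScan, mul_add, ← mul_assoc, Algebra.TensorProduct.tmul_mul_tmul, one_mul,
        mul_one]
    · intro u
      simp only [Algebra.TensorProduct.tmul_mul_tmul, one_mul, mul_one]

theorem delta_word_mul (s : List A) (x : DoubleTensor A) :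
    delta.toLinearMap (word ([] ++ s) * x) = wordScan [] [] s * delta x := by
  simp [delta_word]

/-- Here the inner scan runs over the open right interval. `Q` acts specially only on the first bar
word; beyond it `delta` takes over, so the induction must generalize `Q` and its initial data. -/
theorem tensorRight_wordScan_mul
    (Q : DoubleTensor A →ₗ[ℂ] DoubleTensor A ⊗[ℂ] DoubleTensor A) (c₀ u₀ v₀ : List A)
    (hQ : ∀ c x, Q (word (c₀ ++ c) * x) = wordScan u₀ v₀ c * delta x)
    (y : DoubleTensor A ⊗[ℂ] DoubleTensor A) (l s c : List A) :
    tensorRight Q (wordScan s (c₀ ++ c) l * y) =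
      scan (M := TripleTensor A) (fun v => 1 ⊗ₜ[ℂ] (1 ⊗ₜ[ℂ] word v)) (fun u v => tripleScan s u v l) u₀ v₀ c *
        tensorRight delta.toLinearMap y := by
  induction l generalizing Q c₀ u₀ v₀ s c with
  | nil =>
    rw [wordScan_nil, tensorRight_tmul_mul Q _ _ _ (hQ c), tmul_wordScan]
    rfl
  | cons a l ih =>
    -- If `a` goes left, the open interval closes and the following intervals are new bar words, on
    -- which `delta` acts from empty accumulators.
    have h := ih delta.toLinearMap [] [] [] delta_word_mul (s ++ [a]) []
    rw [wordScan_cons, add_mul, map_add, mul_assoc, tensorRight_tmul_mul Q _ _ _ (hQ c),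
      List.append_assoc, ih Q c₀ u₀ v₀ hQ, scan_append_singleton]
    rw [List.append_nil] at h
    rw [h, ← mul_assoc, ← add_mul, tmul_wordScan]
    congr 1
    rw [scan_mul, ← scan_add]
    congr 1
    funext u v
    simp only [tripleScan, scan, add_assoc]

/-! ### Generation of `H` by words and the coassociativity relations -/

/-- A subspace of `H` that contains `𝟏` and is stable under left multiplication by words is `H`. -/
theorem submodule_eq_top (p : Submodule ℂ (DoubleTensor A)) (h1 : (1 : DoubleTensor A) ∈ p)
    (hw : ∀ (a : A) (l : List A), ∀ x ∈ p, word (a :: l) * x ∈ p) : p = ⊤ := by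
  rw [eq_top_iff]
  rintro y -
  -- Stability under left multiplication by `y` passes to products in `y`, unlike membership of `y`
  -- itself.
  suffices h : ∀ x ∈ p, y * x ∈ p by simpa using h 1 h1
  induction y using TensorAlgebra.induction with
  | algebraMap r =>
    intro x hx
    rw [← Algebra.smul_def]
    exact p.smul_mem r hx
  | mul a b ha hb =>
    intro x hx
    rw [mul_assoc]
    exact ha _ (hb x hx)
  | add a b ha hb =>
    intro x hx
    rw [add_mul]
    exact p.add_mem (ha x hx) (hb x hx)
  | ι w =>
    intro x hx
    induction w using DirectSum.induction_on with
    | zero => simp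
    | add v w hv hw =>
      rw [map_add, add_mul]
      exact p.add_mem hv hw
    | of n w =>
      induction w using PiTensorProduct.induction_on with
      | add v w hv hw =>
        rw [map_add, map_add, add_mul]
        exact p.add_mem hv hw
      | smul_tprod r a =>
        have : TensorAlgebra.ι ℂ (DirectSum.of (fun n => PiTensorProduct ℂ
            (fun _ : Fin (n + 1) => A)) n (r • PiTensorProduct.tprod ℂ a)) =
            r • TensorAlgebra.ι ℂ (pureWord n a) := by
          rw [← LinearMap.map_smul]
          exact congrArg _ ((DirectSum.lof ℂ ℕ (fun n => PiTensorProduct ℂ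
            (fun _ : Fin (n + 1) => A)) n).map_smul r _)
        rw [this, smul_mul_assoc, ← word_map_finRange, List.finRange_succ]
        exact p.smul_mem r (hw _ _ x hx)

theorem hom_ext_word {V : Type*} [AddCommGroup V] [Module ℂ V] {f g : DoubleTensor A →ₗ[ℂ] V}
    (h1 : f 1 = g 1)
    (hw : ∀ (a : A) (l : List A) (x : DoubleTensor A), f x = g x →
      f (word (a :: l) * x) = g (word (a :: l) * x)) : f = g := by
  have h := submodule_eq_top (LinearMap.eqLocus f g) h1 hw
  exact LinearMap.eqLocus_eq_top.1 h

theorem deltaPrec_one : deltaPrec (1 : DoubleTensor A) = 0 := halfExtend_one _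

theorem deltaSucc_one : deltaSucc (1 : DoubleTensor A) = 0 := halfExtend_one _

theorem delta_coassoc_apply (x : DoubleTensor A) :
    tensorLeft delta.toLinearMap (delta x) = tensorRight delta.toLinearMap (delta x) := by
  suffices h : (tensorLeft delta.toLinearMap).comp (delta (A := A)).toLinearMap =
      (tensorRight delta.toLinearMap).comp delta.toLinearMap from LinearMap.congr_fun h x
  apply hom_ext_word
  · simp only [LinearMap.comp_apply, AlgHom.toLinearMap_apply, map_one,
      Algebra.TensorProduct.one_def, tensorLeft_tmul, tensorRight_tmul,
      Algebra.TensorProduct.assoc_tmul]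
  · intro a l x hx
    simp only [LinearMap.comp_apply, AlgHom.toLinearMap_apply] at hx ⊢
    rw [map_mul, delta_word]
    have h₁ := tensorLeft_wordScan_mul delta.toLinearMap [] [] [] delta_word_mul (delta x)
      (a :: l) [] []
    have h₂ := tensorRight_wordScan_mul delta.toLinearMap [] [] [] delta_word_mul (delta x)
      (a :: l) [] []
    rw [List.append_nil] at h₁ h₂
    rw [h₁, h₂, hx]
    rfl

/-- On either side the first letter lands in the first of the three factors; both equal `tripleScan
[a] [] []` times the iterated coproduct of the remaining bar words. The next two relations put the
first letter in the second and in the third factor. -/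
theorem deltaPrec_deltaPrec :
    (tensorLeft deltaPrec).comp (deltaPrec (A := A)) =
      (tensorRight delta.toLinearMap).comp deltaPrec := by
  apply hom_ext_word
  · simp [deltaPrec_one]
  · intro a l x _
    simp only [LinearMap.comp_apply]
    rw [deltaPrec_word_mul]
    have h₁ := tensorLeft_wordScan_mul deltaPrec [a] [a] [] (fun s x => deltaPrec_word_mul a s x)
      (delta x) l [] []
    have h₂ := tensorRight_wordScan_mul delta.toLinearMap [] [] [] delta_word_mul (delta x)
      l [a] []
    rw [List.append_nil] at h₁ h₂
    rw [h₁, h₂, delta_coassoc_apply]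
    rfl

theorem deltaSucc_deltaPrec :
    (tensorLeft deltaSucc).comp (deltaPrec (A := A)) = (tensorRight deltaPrec).comp deltaSucc := by
  apply hom_ext_word
  · simp [deltaPrec_one, deltaSucc_one]
  · intro a l x _
    simp only [LinearMap.comp_apply]
    rw [deltaPrec_word_mul, deltaSucc_word_mul]
    have h₁ := tensorLeft_wordScan_mul deltaSucc [a] [] [a] (fun s x => deltaSucc_word_mul a s x)
      (delta x) l [] []
    have h₂ := tensorRight_wordScan_mul deltaPrec [a] [a] [] (fun s x => deltaPrec_word_mul a s x)
      (delta x) l [] []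
    rw [List.append_nil] at h₁ h₂
    rw [h₁, h₂, delta_coassoc_apply]
    rfl

theorem delta_deltaSucc :
    (tensorLeft delta.toLinearMap).comp (deltaSucc (A := A)) =
      (tensorRight deltaSucc).comp deltaSucc := by
  apply hom_ext_word
  · simp [deltaSucc_one]
  · intro a l x _
    simp only [LinearMap.comp_apply]
    rw [deltaSucc_word_mul]
    have h₁ := tensorLeft_wordScan_mul delta.toLinearMap [] [] [] delta_word_mul (delta x)
      l [] [a]
    have h₂ := tensorRight_wordScan_mul deltaSucc [a] [] [a] (fun s x => deltaSucc_word_mul a s x)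
      (delta x) l [] []
    rw [List.append_nil] at h₁ h₂
    rw [h₁, h₂, delta_coassoc_apply]
    rfl

/-! ### The shuffle identities -/

section Hom

variable {R : Type*} [CommRing R] [Algebra ℂ R]

/-- `m_R ∘ (f ⊗ g ⊗ h)`. -/
def tripleMul (f g h : DoubleTensor A →ₗ[ℂ] R) :
    DoubleTensor A ⊗[ℂ] (DoubleTensor A ⊗[ℂ] DoubleTensor A) →ₗ[ℂ] R :=
  (LinearMap.mul' ℂ R).comp
    (TensorProduct.map f ((LinearMap.mul' ℂ R).comp (TensorProduct.map g h)))

theorem convolve_convolve_left (Q Q' : DoubleTensor A →ₗ[ℂ] DoubleTensor A ⊗[ℂ] DoubleTensor A)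
    (f g h : DoubleTensor A →ₗ[ℂ] R) :
    convolve Q' (convolve Q f g) h = (tripleMul f g h).comp ((tensorLeft Q).comp Q') := by
  have key : (LinearMap.mul' ℂ R).comp (TensorProduct.map (convolve Q f g) h) =
      (tripleMul f g h).comp (tensorLeft Q) := by
    apply TensorProduct.ext'
    intro x y
    simp only [LinearMap.comp_apply, tensorLeft_tmul, TensorProduct.map_tmul,
      LinearMap.mul'_apply, convolve]
    induction Q x using TensorProduct.induction_on with
    | zero => simp
    | add z w hz hw => simp only [map_add, add_mul, TensorProduct.add_tmul, hz, hw]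
    | tmul z w => simp [tripleMul, mul_assoc]
  rw [← LinearMap.comp_assoc, ← key]
  rfl

theorem convolve_convolve_right (Q Q' : DoubleTensor A →ₗ[ℂ] DoubleTensor A ⊗[ℂ] DoubleTensor A)
    (f g h : DoubleTensor A →ₗ[ℂ] R) :
    convolve Q' f (convolve Q g h) = (tripleMul f g h).comp ((tensorRight Q).comp Q') := by
  have key : (LinearMap.mul' ℂ R).comp (TensorProduct.map f (convolve Q g h)) =
      (tripleMul f g h).comp (tensorRight Q) := by
    apply TensorProduct.ext'
    intro x y
    simp [tensorRight_tmul, tripleMul, convolve]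
  rw [← LinearMap.comp_assoc, ← key]
  rfl

theorem starMul_assoc (f g h : DoubleTensor A →ₗ[ℂ] R) :
    starMul (starMul f g) h = starMul f (starMul g h) := by
  simp only [starMul, convolve_convolve_left, convolve_convolve_right]
  congr 1
  ext1 x
  exact delta_coassoc_apply x

/-- This and the next two identities are the dendriform axioms, dual to the three relations between
the half-coproducts. -/
theorem precMul_precMul (f g h : DoubleTensor A →ₗ[ℂ] R) :
    precMul (precMul f g) h = precMul f (starMul g h) := by
  simp only [starMul, precMul, convolve_convolve_left, convolve_convolve_right,
    deltaPrec_deltaPrec]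

theorem precMul_succMul (f g h : DoubleTensor A →ₗ[ℂ] R) :
    precMul (succMul f g) h = succMul f (precMul g h) := by
  simp only [succMul, precMul, convolve_convolve_left, convolve_convolve_right,
    deltaSucc_deltaPrec]

theorem succMul_starMul (f g h : DoubleTensor A →ₗ[ℂ] R) :
    succMul (starMul f g) h = succMul f (succMul g h) := by
  simp only [starMul, succMul, convolve_convolve_left, convolve_convolve_right,
    delta_deltaSucc]

end Hom

/-! ### Counit -/

/-- `counit ⊗ id`. -/
def counitLeft : DoubleTensor A ⊗[ℂ] DoubleTensor A →ₐ[ℂ] DoubleTensor A :=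
  (Algebra.TensorProduct.lid ℂ (DoubleTensor A)).toAlgHom.comp
    (Algebra.TensorProduct.map counit (AlgHom.id ℂ _))

/-- `id ⊗ counit`. -/
def counitRight : DoubleTensor A ⊗[ℂ] DoubleTensor A →ₐ[ℂ] DoubleTensor A :=
  (Algebra.TensorProduct.rid ℂ ℂ (DoubleTensor A)).toAlgHom.comp
    (Algebra.TensorProduct.map (AlgHom.id ℂ _) counit)

theorem counitLeft_tmul (x y : DoubleTensor A) : counitLeft (x ⊗ₜ y) = counit x • y := by
  simp [counitLeft]

theorem counitRight_tmul (x y : DoubleTensor A) : counitRight (x ⊗ₜ y) = counit y • x := by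
  simp [counitRight]

theorem word_nil : word ([] : List A) = 1 := rfl

theorem counit_word (l : List A) : counit (word l) = if l = [] then 1 else 0 := by
  cases l <;> simp [word, counit, TensorAlgebra.algebraMapInv]

theorem counitLeft_wordScan (t u s : List A) :
    counitLeft (wordScan t u s) = if t = [] then word (u ++ s) else 0 := by
  induction s generalizing t u with
  | nil => rw [wordScan_nil, counitLeft_tmul, counit_word]; split_ifs <;> simp
  | cons a s ih => rw [wordScan_cons, map_add, map_mul, ih, ih]; simp

theorem counitRight_wordScan (t u s : List A) :
    counitRight (wordScan t u s) = if u = [] then word (t ++ s) else 0 := by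
  induction s generalizing t u with
  | nil => rw [wordScan_nil, counitRight_tmul, counit_word]; split_ifs <;> simp
  | cons a s ih =>
    rw [wordScan_cons, map_add, map_mul, ih, ih, counitRight_tmul, counit_word]
    split_ifs <;> simp_all

theorem counitLeft_delta (x : DoubleTensor A) : counitLeft (delta x) = x := by
  suffices h : (counitLeft.comp delta).toLinearMap = (LinearMap.id : DoubleTensor A →ₗ[ℂ] _) from
    LinearMap.congr_fun h x
  apply hom_ext_word
  · simp
  · intro a l x hx
    simp only [AlgHom.toLinearMap_apply, AlgHom.comp_apply, LinearMap.id_apply] at hx ⊢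
    simp [hx, delta_word, counitLeft_wordScan]

theorem counitRight_delta (x : DoubleTensor A) : counitRight (delta x) = x := by
  suffices h : (counitRight.comp delta).toLinearMap = (LinearMap.id : DoubleTensor A →ₗ[ℂ] _) from
    LinearMap.congr_fun h x
  apply hom_ext_word
  · simp
  · intro a l x hx
    simp only [AlgHom.toLinearMap_apply, AlgHom.comp_apply, LinearMap.id_apply] at hx ⊢
    simp [hx, delta_word, counitRight_wordScan]

/-! ### Products with `ε`, values at `𝟏`, bilinearity -/

section Hom

variable {R : Type*} [CommRing R] [Algebra ℂ R]

theorem convolve_eps_left (Q : DoubleTensor A →ₗ[ℂ] DoubleTensor A ⊗[ℂ] DoubleTensor A)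
    (f : DoubleTensor A →ₗ[ℂ] R) :
    convolve Q eps f = (f.comp counitLeft.toLinearMap).comp Q := by
  have : (LinearMap.mul' ℂ R).comp (TensorProduct.map eps f) =
      f.comp (counitLeft (A := A)).toLinearMap := by
    apply TensorProduct.ext'
    intro x y
    simp [counitLeft_tmul, eps, ← Algebra.smul_def]
  rw [← this]
  rfl

theorem convolve_eps_right (Q : DoubleTensor A →ₗ[ℂ] DoubleTensor A ⊗[ℂ] DoubleTensor A)
    (f : DoubleTensor A →ₗ[ℂ] R) :
    convolve Q f eps = (f.comp counitRight.toLinearMap).comp Q := by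
  have : (LinearMap.mul' ℂ R).comp (TensorProduct.map f eps) =
      f.comp (counitRight (A := A)).toLinearMap := by
    apply TensorProduct.ext'
    intro x y
    simp [counitRight_tmul, eps, mul_comm (f x), ← Algebra.smul_def]
  rw [← this]
  rfl

theorem eps_starMul (f : DoubleTensor A →ₗ[ℂ] R) : starMul eps f = f := by
  ext1 x
  simp [starMul, convolve_eps_left, counitLeft_delta]

theorem starMul_eps (f : DoubleTensor A →ₗ[ℂ] R) : starMul f eps = f := by
  ext1 x
  simp [starMul, convolve_eps_right, counitRight_delta]

theorem eps_precMul (f : DoubleTensor A →ₗ[ℂ] R) : precMul eps f = 0 := by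
  apply hom_ext_word
  · simp [precMul, convolve_eps_left, deltaPrec_one]
  · intro a l x _
    simp [precMul, convolve_eps_left, deltaPrec_word_mul, counitLeft_wordScan]

theorem succMul_eps (f : DoubleTensor A →ₗ[ℂ] R) : succMul f eps = 0 := by
  apply hom_ext_word
  · simp [succMul, convolve_eps_right, deltaSucc_one]
  · intro a l x _
    simp [succMul, convolve_eps_right, deltaSucc_word_mul, counitRight_wordScan]

theorem precMul_eps (f : DoubleTensor A →ₗ[ℂ] R) (hf : f 1 = 0) : precMul f eps = f := by
  apply hom_ext_word
  · simp [precMul, convolve_eps_right, deltaPrec_one, hf]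
  · intro a l x _
    simp [precMul, convolve_eps_right, deltaPrec_word_mul, counitRight_wordScan,
      counitRight_delta]

theorem eps_succMul (f : DoubleTensor A →ₗ[ℂ] R) (hf : f 1 = 0) : succMul eps f = f := by
  apply hom_ext_word
  · simp [succMul, convolve_eps_left, deltaSucc_one, hf]
  · intro a l x _
    simp [succMul, convolve_eps_left, deltaSucc_word_mul, counitLeft_wordScan,
      counitLeft_delta]

theorem precMul_apply_one (f g : DoubleTensor A →ₗ[ℂ] R) : precMul f g 1 = 0 := by
  simp [precMul, convolve, deltaPrec_one]

theorem succMul_apply_one (f g : DoubleTensor A →ₗ[ℂ] R) : succMul f g 1 = 0 := by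
  simp [succMul, convolve, deltaSucc_one]

theorem starMul_apply_one (f g : DoubleTensor A →ₗ[ℂ] R) : starMul f g 1 = f 1 * g 1 := by
  simp [starMul, convolve, Algebra.TensorProduct.one_def]

theorem eps_apply_one : (eps : DoubleTensor A →ₗ[ℂ] R) 1 = 1 := by
  simp [eps]

/-- The half-products vanish at `𝟏`, where the convolution product is `f 1 * g 1`; away from `𝟏` the
coproduct is the sum of its halves. -/
theorem starMul_eq_add (f g : DoubleTensor A →ₗ[ℂ] R) (h : f 1 * g 1 = 0) :
    starMul f g = precMul f g + succMul f g := by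
  apply hom_ext_word
  · simp [precMul_apply_one, succMul_apply_one, starMul_apply_one, h]
  · intro a l x _
    simp only [starMul, precMul, succMul, convolve, LinearMap.comp_apply, LinearMap.add_apply,
      AlgHom.toLinearMap_apply]
    rw [word_cons_eq, delta_eq_add, map_add, map_add]

/-- The products `m_R ∘ (f ⊗ g) ∘ Q` as a bilinear map. -/
def convolveBilin (Q : DoubleTensor A →ₗ[ℂ] DoubleTensor A ⊗[ℂ] DoubleTensor A) :
    (DoubleTensor A →ₗ[ℂ] R) →ₗ[ℂ] (DoubleTensor A →ₗ[ℂ] R) →ₗ[ℂ] (DoubleTensor A →ₗ[ℂ] R) :=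
  LinearMap.mk₂ ℂ (convolve Q)
    (fun f g h => by
      simp [convolve, TensorProduct.map_add_left, LinearMap.add_comp, LinearMap.comp_add])
    (fun c f g => by
      simp [convolve, TensorProduct.map_smul_left, LinearMap.smul_comp, LinearMap.comp_smul])
    (fun f g h => by
      simp [convolve, TensorProduct.map_add_right, LinearMap.add_comp, LinearMap.comp_add])
    (fun c f g => by
      simp [convolve, TensorProduct.map_smul_right, LinearMap.smul_comp, LinearMap.comp_smul])

theorem starMul_eq_bilin (f g : DoubleTensor A →ₗ[ℂ] R) :
    starMul f g = convolveBilin delta.toLinearMap f g := rfl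

theorem precMul_eq_bilin (f g : DoubleTensor A →ₗ[ℂ] R) :
    precMul f g = convolveBilin deltaPrec f g := rfl

theorem succMul_eq_bilin (f g : DoubleTensor A →ₗ[ℂ] R) :
    succMul f g = convolveBilin deltaSucc f g := rfl

end Hom

/-! ### The filtration by the number of letters -/

/-- The bar product of a list of words. -/
def bar (L : List (List A)) : DoubleTensor A := (L.map word).prod

theorem bar_cons (w : List A) (L : List (List A)) : bar (w :: L) = word w * bar L := by
  simp [bar]

theorem bar_append (L L' : List (List A)) : bar (L ++ L') = bar L * bar L' := by
  simp [bar]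

/-- Lists may contain empty words, so having no letters means being a list of empty words, each
equal to `1`. -/
theorem bar_eq_one {L : List (List A)} (h : L.flatten = []) : bar L = 1 := by
  rw [List.flatten_eq_nil_iff] at h
  exact List.prod_eq_one (by
    intro x hx
    obtain ⟨w, hw, rfl⟩ := List.mem_map.1 hx
    rw [h w hw, word_nil])

theorem span_range_bar : Submodule.span ℂ (Set.range (bar (A := A))) = ⊤ := by
  apply submodule_eq_top
  · exact Submodule.subset_span ⟨[], rfl⟩
  · intro a l x hx
    induction hx using Submodule.span_induction with
    | mem x h =>
      obtain ⟨L, rfl⟩ := h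
      exact Submodule.subset_span ⟨(a :: l) :: L, bar_cons _ _⟩
    | zero => simp
    | add x y _ _ hx hy =>
      rw [mul_add]
      exact Submodule.add_mem _ hx hy
    | smul c x _ hx =>
      rw [mul_smul_comm]
      exact Submodule.smul_mem _ c hx

/-- The part of `H ⊗ H` with `n` letters in total. -/
def tensorDegree (n : ℕ) : Submodule ℂ (DoubleTensor A ⊗[ℂ] DoubleTensor A) :=
  Submodule.span ℂ {z | ∃ L L' : List (List A),
    L.flatten.length + L'.flatten.length = n ∧ z = bar L ⊗ₜ bar L'}

theorem bar_tmul_bar_mem (L L' : List (List A)) {n : ℕ}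
    (h : L.flatten.length + L'.flatten.length = n) :
    bar L ⊗ₜ[ℂ] bar L' ∈ tensorDegree (A := A) n :=
  Submodule.subset_span ⟨L, L', h, rfl⟩

theorem mul_mem_tensorDegree {m n : ℕ} {x y : DoubleTensor A ⊗[ℂ] DoubleTensor A}
    (hx : x ∈ tensorDegree m) (hy : y ∈ tensorDegree n) : x * y ∈ tensorDegree (m + n) := by
  have h := Submodule.mul_mem_mul hx hy
  rw [tensorDegree, tensorDegree, Submodule.span_mul_span] at h
  refine Submodule.span_mono ?_ h
  rintro _ ⟨_, ⟨K, K', hK, rfl⟩, _, ⟨L, L', hL, rfl⟩, rfl⟩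
  refine ⟨K ++ L, K' ++ L', ?_, ?_⟩
  · simp only [List.flatten_append, List.length_append]
    omega
  · simp [bar_append]

theorem wordScan_mem_tensorDegree (t u s : List A) :
    wordScan t u s ∈ tensorDegree (t.length + u.length + s.length) := by
  induction s generalizing t u with
  | nil =>
    have := bar_tmul_bar_mem [t] [u] rfl
    simpa [bar, wordScan_nil] using this
  | cons a s ih =>
    rw [wordScan_cons]
    refine Submodule.add_mem _ ?_ ?_
    · have h : (1 : DoubleTensor A) ⊗ₜ[ℂ] word u ∈ tensorDegree (A := A) u.length := by
        simpa [bar] using bar_tmul_bar_mem [] [u] rfl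
      convert mul_mem_tensorDegree h (ih (t ++ [a]) []) using 2
      simp only [List.length_append, List.length_cons, List.length_nil]
      omega
    · convert ih t (u ++ [a]) using 2
      simp only [List.length_append, List.length_cons, List.length_nil]
      omega

/-- A map `H → H ⊗ H` that preserves the total number of letters. -/
def PreservesDegree (Q : DoubleTensor A →ₗ[ℂ] DoubleTensor A ⊗[ℂ] DoubleTensor A) : Prop :=
  ∀ L : List (List A), Q (bar L) ∈ tensorDegree L.flatten.length

theorem preservesDegree_delta : PreservesDegree (delta (A := A)).toLinearMap := by
  intro L
  induction L with
  | nil =>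
    simpa [bar, Algebra.TensorProduct.one_def] using bar_tmul_bar_mem ([] : List (List A)) [] rfl
  | cons w L ih =>
    rw [AlgHom.toLinearMap_apply] at ih ⊢
    rw [bar_cons, map_mul, delta_word, List.flatten_cons, List.length_append]
    exact mul_mem_tensorDegree (by simpa using wordScan_mem_tensorDegree [] [] w) ih

theorem preservesDegree_deltaPrec : PreservesDegree (deltaPrec (A := A)) := by
  intro L
  induction L with
  | nil => simp [bar, deltaPrec_one]
  | cons w L ih =>
    cases w with
    | nil => simpa [bar_cons, word_nil] using ih
    | cons a l =>
      rw [bar_cons, deltaPrec_word_mul, List.flatten_cons, List.length_append]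
      refine mul_mem_tensorDegree ?_ (preservesDegree_delta L)
      convert wordScan_mem_tensorDegree [a] [] l using 2
      simp only [List.length_cons, List.length_nil]
      omega

theorem preservesDegree_deltaSucc : PreservesDegree (deltaSucc (A := A)) := by
  intro L
  induction L with
  | nil => simp [bar, deltaSucc_one]
  | cons w L ih =>
    cases w with
    | nil => simpa [bar_cons, word_nil] using ih
    | cons a l =>
      rw [bar_cons, deltaSucc_word_mul, List.flatten_cons, List.length_append]
      refine mul_mem_tensorDegree ?_ (preservesDegree_delta L)
      convert wordScan_mem_tensorDegree [] [a] l using 2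
      simp only [List.length_cons, List.length_nil]
      omega

/-! ### The filtration on functionals -/

section Hom

variable {R : Type*} [CommRing R] [Algebra ℂ R]

/-- The functionals that vanish on bar words with fewer than `N` letters. -/
def vanishing (A R : Type*) [Ring A] [Algebra ℂ A] [CommRing R] [Algebra ℂ R] (N : ℕ) :
    Submodule ℂ (DoubleTensor A →ₗ[ℂ] R) where
  carrier := {f | ∀ L : List (List A), L.flatten.length < N → f (bar L) = 0}
  zero_mem' := fun _ _ => rfl
  add_mem' hf hg L hL := by simp [hf L hL, hg L hL]
  smul_mem' c f hf L hL := by simp [hf L hL]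

theorem vanishing_antitone : Antitone (vanishing A R) :=
  fun _ _ h _ hf L hL => hf L (hL.trans_le h)

theorem mem_vanishing_zero (f : DoubleTensor A →ₗ[ℂ] R) : f ∈ vanishing A R 0 :=
  fun _ h => absurd h (Nat.not_lt_zero _)

theorem mem_vanishing_one {f : DoubleTensor A →ₗ[ℂ] R} (hf : f 1 = 0) : f ∈ vanishing A R 1 := by
  intro L hL
  rw [bar_eq_one (List.length_eq_zero_iff.1 (Nat.lt_one_iff.1 hL)), hf]

theorem comp_mem_vanishing {R' : Type*} [CommRing R'] [Algebra ℂ R'] {N : ℕ}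
    {f : DoubleTensor A →ₗ[ℂ] R} (hf : f ∈ vanishing A R N) (g : R →ₗ[ℂ] R') :
    g.comp f ∈ vanishing A R' N := by
  intro L hL
  simp [hf L hL]

/-- An element of `H` is a finite combination of bar words, so their lengths are bounded. This makes
the filtration separated and lets identities be checked modulo each `vanishing A R N`. -/
theorem exists_forall_vanishing_apply_eq_zero (R : Type*) [CommRing R] [Algebra ℂ R]
    (x : DoubleTensor A) : ∃ N, ∀ f ∈ vanishing A R N, f x = 0 := by
  have hx : x ∈ Submodule.span ℂ (Set.range (bar (A := A))) := by
    rw [span_range_bar]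
    trivial
  induction hx using Submodule.span_induction with
  | mem x h =>
    obtain ⟨L, rfl⟩ := h
    exact ⟨L.flatten.length + 1, fun f hf => hf L (Nat.lt_succ_self _)⟩
  | zero => exact ⟨0, fun f _ => map_zero f⟩
  | add x y _ _ hx hy =>
    obtain ⟨M, hM⟩ := hx
    obtain ⟨N, hN⟩ := hy
    refine ⟨max M N, fun f hf => ?_⟩
    rw [map_add, hM f (vanishing_antitone (le_max_left _ _) hf),
      hN f (vanishing_antitone (le_max_right _ _) hf), add_zero]
  | smul c x _ hx =>
    obtain ⟨N, hN⟩ := hx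
    exact ⟨N, fun f hf => by rw [map_smul, hN f hf, smul_zero]⟩

theorem eq_zero_of_forall_mem_vanishing {f : DoubleTensor A →ₗ[ℂ] R}
    (h : ∀ N, f ∈ vanishing A R N) : f = 0 := by
  ext1 x
  obtain ⟨N, hN⟩ := exists_forall_vanishing_apply_eq_zero R x
  exact hN f (h N)

/-- If fewer than `p + q` letters are shared out, the left factor has fewer than `p` or the right
one fewer than `q`. -/
theorem convolve_mem_vanishing {Q : DoubleTensor A →ₗ[ℂ] DoubleTensor A ⊗[ℂ] DoubleTensor A}
    (hQ : PreservesDegree Q) {p q : ℕ} {f g : DoubleTensor A →ₗ[ℂ] R}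
    (hf : f ∈ vanishing A R p) (hg : g ∈ vanishing A R q) :
    convolve Q f g ∈ vanishing A R (p + q) := by
  intro L hL
  have h := hQ L
  rw [convolve, LinearMap.comp_apply, LinearMap.comp_apply]
  generalize Q (bar L) = z at h ⊢
  unfold tensorDegree at h
  induction h using Submodule.span_induction with
  | mem z hz =>
    obtain ⟨K, K', hK, rfl⟩ := hz
    rw [TensorProduct.map_tmul, LinearMap.mul'_apply]
    rcases lt_or_ge K.flatten.length p with hp | hp
    · rw [hf K hp, zero_mul]
    · rw [hg K' (by omega), mul_zero]
  | zero => simp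
  | add x y _ _ hx hy => rw [map_add, map_add, hx, hy, add_zero]
  | smul c x _ hx => rw [map_smul, map_smul, hx, smul_zero]

theorem starMul_mem_vanishing {p q : ℕ} {f g : DoubleTensor A →ₗ[ℂ] R}
    (hf : f ∈ vanishing A R p) (hg : g ∈ vanishing A R q) :
    starMul f g ∈ vanishing A R (p + q) :=
  convolve_mem_vanishing preservesDegree_delta hf hg

/-- Each use of the equation raises the order of vanishing of `d` by one, since `κ` has order at
least one. -/
theorem eq_zero_of_eq_precMul {κ d : DoubleTensor A →ₗ[ℂ] R} (hκ : κ 1 = 0)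
    (h : d = precMul κ d) : d = 0 := by
  refine eq_zero_of_forall_mem_vanishing fun N => ?_
  induction N with
  | zero => exact mem_vanishing_zero d
  | succ N ih =>
    rw [h, add_comm]
    exact convolve_mem_vanishing preservesDegree_deltaPrec (mem_vanishing_one hκ) ih

theorem eq_zero_of_eq_succMul {β d : DoubleTensor A →ₗ[ℂ] R} (hβ : β 1 = 0)
    (h : d = succMul d β) : d = 0 := by
  refine eq_zero_of_forall_mem_vanishing fun N => ?_
  induction N with
  | zero => exact mem_vanishing_zero d
  | succ N ih =>
    rw [h]
    exact convolve_mem_vanishing preservesDegree_deltaSucc ih (mem_vanishing_one hβ)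

/-! ### Locally finite series -/

theorem locallyFiniteSeries_of_mem {t : ℕ → DoubleTensor A →ₗ[ℂ] R}
    (ht : ∀ n, t n ∈ vanishing A R n) : LocallyFiniteSeries t := by
  intro x
  obtain ⟨N, hN⟩ := exists_forall_vanishing_apply_eq_zero R x
  refine (Set.finite_lt_nat N).subset fun n hn => ?_
  by_contra h
  exact hn (hN _ (vanishing_antitone (not_lt.1 h) (ht n)))

theorem seriesSum_sub_mem {t : ℕ → DoubleTensor A →ₗ[ℂ] R}
    (ht : ∀ n, t n ∈ vanishing A R n) (N : ℕ) :
    seriesSum t - ∑ n ∈ Finset.range N, t n ∈ vanishing A R N := by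
  intro L hL
  rw [seriesSum, dif_pos (locallyFiniteSeries_of_mem ht), LinearMap.sub_apply, sub_eq_zero,
    LinearMap.sum_apply]
  refine finsum_eq_sum_of_support_subset _ fun n hn => ?_
  by_contra h
  rw [Finset.mem_coe, Finset.mem_range, not_lt] at h
  exact hn (vanishing_antitone h (ht n) L hL)

theorem convPow_mem_vanishing {f : DoubleTensor A →ₗ[ℂ] R} (hf : f 1 = 0) (n : ℕ) :
    convPow f n ∈ vanishing A R n := by
  induction n with
  | zero => exact mem_vanishing_zero _
  | succ n ih =>
    have h := starMul_mem_vanishing (mem_vanishing_one hf) ih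
    rw [add_comm] at h
    exact h

theorem convPow_starMul (f : DoubleTensor A →ₗ[ℂ] R) (n : ℕ) :
    starMul (convPow f n) f = convPow f (n + 1) := by
  induction n with
  | zero => simp [convPow, eps_starMul, starMul_eps]
  | succ n ih =>
    conv_lhs => rw [convPow, starMul_assoc, ih]
    rfl

/-! ### Convolution inverses -/

/-- The inverse is the Neumann series `∑ ν^{⋆ n}` with `ν = ε - f`, which is locally finite because
`ν 1 = 0`. Each identity is checked modulo order `N`: the truncated product telescopes to `ε - ν^{⋆
N}`, and both `ν^{⋆ N}` and the tail have order `N`. -/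
theorem exists_isConvInverse {f : DoubleTensor A →ₗ[ℂ] R} (hf : f 1 = 1) :
    ∃ g, IsConvInverse f g := by
  set ν := eps - f with hν
  have hν1 : ν 1 = 0 := by simp [hν, eps_apply_one, hf]
  have hfν : f = eps - ν := by simp [hν]
  have ht := convPow_mem_vanishing hν1
  refine ⟨seriesSum (convPow ν), ?_, ?_⟩
  · rw [← sub_eq_zero]
    refine eq_zero_of_forall_mem_vanishing fun N => ?_
    have hS : starMul f (∑ n ∈ Finset.range N, convPow ν n) = eps - convPow ν N := by
      rw [starMul_eq_bilin, hfν, map_sub, LinearMap.sub_apply, ← starMul_eq_bilin, eps_starMul,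
        map_sum, ← Finset.sum_sub_distrib]
      exact Finset.sum_range_sub' (convPow ν) N
    have h := starMul_mem_vanishing (mem_vanishing_zero f) (seriesSum_sub_mem ht N)
    rw [starMul_eq_bilin, map_sub, ← starMul_eq_bilin, ← starMul_eq_bilin, hS, zero_add] at h
    convert (vanishing A R N).sub_mem h (ht N) using 1
    abel
  · rw [← sub_eq_zero]
    refine eq_zero_of_forall_mem_vanishing fun N => ?_
    have hS : starMul (∑ n ∈ Finset.range N, convPow ν n) f = eps - convPow ν N := by
      rw [starMul_eq_bilin, hfν, map_sub, ← starMul_eq_bilin, starMul_eps, map_sum,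
        LinearMap.sum_apply, ← Finset.sum_sub_distrib]
      refine Eq.trans (Finset.sum_congr rfl fun n _ => ?_) (Finset.sum_range_sub' (convPow ν) N)
      rw [← starMul_eq_bilin, convPow_starMul]
    have h := starMul_mem_vanishing (seriesSum_sub_mem ht N) (mem_vanishing_zero f)
    rw [starMul_eq_bilin, map_sub, LinearMap.sub_apply, ← starMul_eq_bilin, ← starMul_eq_bilin,
      hS, add_zero] at h
    convert (vanishing A R N).sub_mem h (ht N) using 1
    abel

theorem isConvInverse_convInv {f : DoubleTensor A →ₗ[ℂ] R} (hf : f 1 = 1) :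
    IsConvInverse f (convInv f) := by
  have h := exists_isConvInverse hf
  rw [convInv, dif_pos h]
  exact h.choose_spec

theorem IsConvInverse.symm {f g : DoubleTensor A →ₗ[ℂ] R} (h : IsConvInverse f g) :
    IsConvInverse g f := ⟨h.2, h.1⟩

theorem IsConvInverse.unique {f g g' : DoubleTensor A →ₗ[ℂ] R} (h : IsConvInverse f g)
    (h' : IsConvInverse f g') : g = g' := by
  rw [← starMul_eps g, ← h'.1, ← starMul_assoc, h.2, eps_starMul]

theorem IsConvInverse.convInv_eq {f g : DoubleTensor A →ₗ[ℂ] R} (h : IsConvInverse f g) :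
    convInv f = g := by
  have he : ∃ g, IsConvInverse f g := ⟨g, h⟩
  rw [convInv, dif_pos he]
  exact he.choose_spec.unique h

/-! ### Linearised fixed-point equations -/

/-- With `Y = Ψ ≻ (κ' ≺ Φ)`, cancelling `Φ ⋆ Ψ = ε` gives `Φ ≻ Y = κ' ≺ Φ`, and inserting the
equation for `Φ` gives `Φ ≺ Y = κ ≺ (Φ ⋆ Y)`. Their sum says that `Φ ⋆ Y` solves the equation of
`X`, whose solution is unique. -/
theorem eq_starMul_shuffleAdjoint {Φ Ψ κ κ' X : DoubleTensor A →ₗ[ℂ] R} (hΨ : IsConvInverse Φ Ψ)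
    (hκ : κ 1 = 0) (hΦ : Φ = eps + precMul κ Φ) (hX : X = precMul κ' Φ + precMul κ X) :
    X = starMul Φ (shuffleAdjoint Φ κ') := by
  rw [shuffleAdjoint, hΨ.convInv_eq, precMul_succMul]
  set Y := succMul Ψ (precMul κ' Φ) with hY
  have hY1 : Y 1 = 0 := succMul_apply_one _ _
  have hs : succMul Φ Y = precMul κ' Φ := by
    rw [hY, ← succMul_starMul, hΨ.1, eps_succMul _ (precMul_apply_one _ _)]
  have hp : precMul Φ Y = precMul κ (starMul Φ Y) := by
    conv_lhs => rw [hΦ]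
    rw [precMul_eq_bilin, map_add, LinearMap.add_apply, ← precMul_eq_bilin, eps_precMul, zero_add,
      ← precMul_eq_bilin, precMul_precMul]
  have h : starMul Φ Y = precMul κ' Φ + precMul κ (starMul Φ Y) := by
    rw [← hp, ← hs, add_comm]
    exact starMul_eq_add _ _ (by rw [hY1, mul_zero])
  rw [← sub_eq_zero]
  -- The inhomogeneous term `κ' ≺ Φ` cancels in the difference.
  refine eq_zero_of_eq_precMul hκ ?_
  rw [precMul_eq_bilin, map_sub, ← precMul_eq_bilin, ← precMul_eq_bilin]
  conv_lhs => rw [hX, h]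
  abel

/-- Mirror image of the free case: with `Z = (Φ ≻ β') ≺ Ψ`, one has `Z ≺ Φ = Φ ≻ β'` and `Z ≻ Φ = (Z
⋆ Φ) ≻ β`. -/
theorem eq_shuffleAdjoint_starMul {Φ Ψ β β' X : DoubleTensor A →ₗ[ℂ] R} (hΨ : IsConvInverse Φ Ψ)
    (hβ : β 1 = 0) (hΦ : Φ = eps + succMul Φ β) (hX : X = succMul Φ β' + succMul X β) :
    X = starMul (shuffleAdjoint Ψ β') Φ := by
  rw [shuffleAdjoint, hΨ.symm.convInv_eq]
  set Z := precMul (succMul Φ β') Ψ with hZ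
  have hZ1 : Z 1 = 0 := precMul_apply_one _ _
  have hp : precMul Z Φ = succMul Φ β' := by
    rw [hZ, precMul_precMul, hΨ.2, precMul_eps _ (succMul_apply_one _ _)]
  have hs : succMul Z Φ = succMul (starMul Z Φ) β := by
    conv_lhs => rw [hΦ]
    rw [succMul_eq_bilin, map_add, ← succMul_eq_bilin, succMul_eps, zero_add,
      ← succMul_eq_bilin, succMul_starMul]
  have h : starMul Z Φ = succMul Φ β' + succMul (starMul Z Φ) β := by
    rw [← hs, ← hp]
    exact starMul_eq_add _ _ (by rw [hZ1, zero_mul])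
  rw [← sub_eq_zero]
  refine eq_zero_of_eq_succMul hβ ?_
  rw [succMul_eq_bilin, map_sub, LinearMap.sub_apply, ← succMul_eq_bilin, ← succMul_eq_bilin]
  conv_lhs => rw [hX, h]
  abel

end Hom

/-! ### Grassmann-valued products -/

theorem fst_grassmann {V : Type*} [AddCommGroup V] [Module ℂ V] (f f' : V →ₗ[ℂ] ℂ) (x : V) :
    (grassmann f f' x).fst = f x := by
  simp [grassmann]

theorem snd_grassmann {V : Type*} [AddCommGroup V] [Module ℂ V] (f f' : V →ₗ[ℂ] ℂ) (x : V) :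
    (grassmann f f' x).snd = f' x := by
  simp [grassmann]

theorem grassmann_inj {V : Type*} [AddCommGroup V] [Module ℂ V] {f f' g g' : V →ₗ[ℂ] ℂ}
    (h : grassmann f f' = grassmann g g') : f = g ∧ f' = g' := by
  constructor <;> ext1 x
  · rw [← fst_grassmann f f', h, fst_grassmann]
  · rw [← snd_grassmann f f', h, snd_grassmann]

theorem grassmann_add {V : Type*} [AddCommGroup V] [Module ℂ V] (f f' g g' : V →ₗ[ℂ] ℂ) :
    grassmann f f' + grassmann g g' = grassmann (f + g) (f' + g') := by
  ext1 x
  apply TrivSqZeroExt.ext <;> simp [fst_grassmann, snd_grassmann]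

theorem convolve_grassmann (Q : DoubleTensor A →ₗ[ℂ] DoubleTensor A ⊗[ℂ] DoubleTensor A)
    (f f' g g' : DoubleTensor A →ₗ[ℂ] ℂ) :
    convolve Q (grassmann f f') (grassmann g g') =
      grassmann (convolve Q f g) (convolve Q f g' + convolve Q f' g) := by
  ext1 x
  apply TrivSqZeroExt.ext
  · simp only [fst_grassmann, convolve, LinearMap.comp_apply]
    induction Q x using TensorProduct.induction_on with
    | zero => simp
    | add y z hy hz => simp only [map_add, TrivSqZeroExt.fst_add, hy, hz]
    | tmul y z => simp [fst_grassmann]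
  · simp only [snd_grassmann, convolve, LinearMap.comp_apply, LinearMap.add_apply]
    induction Q x using TensorProduct.induction_on with
    | zero => simp
    | add y z hy hz =>
      simp only [map_add, TrivSqZeroExt.snd_add, hy, hz]
      ring
    | tmul y z => simp [fst_grassmann, snd_grassmann]

theorem eps_eq_grassmann :
    (eps : DoubleTensor A →ₗ[ℂ] DualNumber ℂ) = grassmann eps 0 := by
  ext1 x
  apply TrivSqZeroExt.ext <;>
    simp [fst_grassmann, snd_grassmann, eps, TrivSqZeroExt.algebraMap_eq_inl]

theorem apply_one_of_grassmann {f f' : DoubleTensor A →ₗ[ℂ] ℂ}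
    (h : IsInfinitesimalCharacter (grassmann f f')) : f 1 = 0 ∧ f' 1 = 0 := by
  constructor
  · rw [← fst_grassmann f f', h.1, TrivSqZeroExt.fst_zero]
  · rw [← snd_grassmann f f', h.1, TrivSqZeroExt.snd_zero]

theorem starMul_smul_left (c : ℂ) (f g : DoubleTensor A →ₗ[ℂ] ℂ) :
    starMul (c • f) g = c • starMul f g :=
  (convolveBilin delta.toLinearMap).map_smul₂ c f g

theorem starMul_smul_right (c : ℂ) (f g : DoubleTensor A →ₗ[ℂ] ℂ) :
    starMul f (c • g) = c • starMul f g :=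
  (convolveBilin delta.toLinearMap f).map_smul c g

theorem starMul_sub_left (f g h : DoubleTensor A →ₗ[ℂ] ℂ) :
    starMul (f - g) h = starMul f h - starMul g h :=
  (convolveBilin delta.toLinearMap).map_sub₂ f g h

theorem starMul_sub_right (f g h : DoubleTensor A →ₗ[ℂ] ℂ) :
    starMul f (g - h) = starMul f g - starMul f h :=
  (convolveBilin delta.toLinearMap f).map_sub g h

theorem starMul_sum_left {ι : Type*} (s : Finset ι) (f : ι → DoubleTensor A →ₗ[ℂ] ℂ)
    (g : DoubleTensor A →ₗ[ℂ] ℂ) : starMul (∑ i ∈ s, f i) g = ∑ i ∈ s, starMul (f i) g :=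
  (convolveBilin delta.toLinearMap).map_sum₂ s f g

theorem starMul_sum_right {ι : Type*} (s : Finset ι) (f : DoubleTensor A →ₗ[ℂ] ℂ)
    (g : ι → DoubleTensor A →ₗ[ℂ] ℂ) : starMul f (∑ i ∈ s, g i) = ∑ i ∈ s, starMul f (g i) :=
  map_sum (convolveBilin delta.toLinearMap f) g s

/-! ### The derivative of the convolution exponential -/

/-- The sum with index `n` is formally `((l + d)^n - l^n) / d`, and `(l + d)^(n+1) - l^(n+1) = l ((l
+ d)^n - l^n) + d (l + d)^n`. Pascal's rule replaces the division by `d`. -/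
theorem pow_sum_succ {E : Type*} [Ring E] (l d : E) (h : Commute l d) (n : ℕ) :
    ∑ k ∈ Finset.range (n + 1), ((n + 1).choose k) • (l ^ k * d ^ (n - k)) =
      l * ∑ k ∈ Finset.range n, (n.choose k) • (l ^ k * d ^ (n - 1 - k)) + (l + d) ^ n := by
  rw [h.add_pow, Finset.sum_range_succ', Finset.sum_range_succ' _ n, Finset.mul_sum, ← add_assoc,
    ← Finset.sum_add_distrib]
  congr 1
  · refine Finset.sum_congr rfl fun k _ => ?_
    rw [Nat.choose_succ_succ, add_smul, mul_smul_comm, ← mul_assoc, ← pow_succ',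
      show n - 1 - k = n - (k + 1) by omega]
    simp only [nsmul_eq_mul']
  · simp

/-- The `ħ`-coefficient of the convolution power `(ρ + ħ ρ')^{⋆ n}`. -/
def convPowDeriv (ρ ρ' : DoubleTensor A →ₗ[ℂ] ℂ) : ℕ → DoubleTensor A →ₗ[ℂ] ℂ
  | 0 => 0
  | n + 1 => starMul ρ (convPowDeriv ρ ρ' n) + starMul ρ' (convPow ρ n)

theorem convPow_grassmann (ρ ρ' : DoubleTensor A →ₗ[ℂ] ℂ) (n : ℕ) :
    convPow (grassmann ρ ρ') n = grassmann (convPow ρ n) (convPowDeriv ρ ρ' n) := by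
  induction n with
  | zero => exact eps_eq_grassmann
  | succ n ih => rw [convPow, ih, starMul, convolve_grassmann]; rfl

/-- Left multiplication by `ρ`. -/
def leftEnd (ρ : DoubleTensor A →ₗ[ℂ] ℂ) : Module.End ℂ (DoubleTensor A →ₗ[ℂ] ℂ) :=
  convolveBilin delta.toLinearMap ρ

/-- Right multiplication by `ρ`. -/
def rightEnd (ρ : DoubleTensor A →ₗ[ℂ] ℂ) : Module.End ℂ (DoubleTensor A →ₗ[ℂ] ℂ) :=
  (convolveBilin delta.toLinearMap).flip ρ

theorem leftEnd_apply (ρ f : DoubleTensor A →ₗ[ℂ] ℂ) : leftEnd ρ f = starMul ρ f := rfl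

theorem rightEnd_apply (ρ f : DoubleTensor A →ₗ[ℂ] ℂ) : rightEnd ρ f = starMul f ρ := rfl

theorem commute_leftEnd_rightEnd (ρ : DoubleTensor A →ₗ[ℂ] ℂ) :
    Commute (leftEnd ρ) (rightEnd ρ) :=
  LinearMap.ext fun f => (starMul_assoc ρ f ρ).symm

theorem leftEnd_pow_apply (ρ f : DoubleTensor A →ₗ[ℂ] ℂ) (n : ℕ) :
    (leftEnd ρ ^ n) f = starMul (convPow ρ n) f := by
  induction n with
  | zero => simp [convPow, eps_starMul]
  | succ n ih =>
    rw [pow_succ', Module.End.mul_apply, ih, leftEnd_apply, ← starMul_assoc]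
    rfl

theorem rightEnd_pow_apply (ρ f : DoubleTensor A →ₗ[ℂ] ℂ) (n : ℕ) :
    (rightEnd ρ ^ n) f = starMul f (convPow ρ n) := by
  induction n generalizing f with
  | zero => simp [convPow, starMul_eps]
  | succ n ih =>
    rw [pow_succ, Module.End.mul_apply, ih, rightEnd_apply, starMul_assoc]
    rfl

theorem adBracket_iterate (ρ f : DoubleTensor A →ₗ[ℂ] ℂ) (n : ℕ) :
    (adBracket ρ)^[n] f = (-1 : ℂ) ^ n • ((rightEnd ρ - leftEnd ρ) ^ n) f := by
  induction n with
  | zero => simp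
  | succ n ih =>
    have h : ∀ g, adBracket ρ g = -(rightEnd ρ - leftEnd ρ) g := fun g => by
      rw [LinearMap.sub_apply, neg_sub]
      rfl
    rw [Function.iterate_succ_apply', ih, h, map_smul, pow_succ' (rightEnd ρ - leftEnd ρ),
      pow_succ' (-1 : ℂ), Module.End.mul_apply, mul_smul, neg_one_smul]

/-- For `l = L` and `d = R - L` the recursion of `pow_sum_succ` is that of `convPowDeriv`, as `(l +
d)^n ρ' = R^n ρ' = ρ' ⋆ ρ^{⋆ n}`. The point of the form is that `d = -ad_ρ`. -/
theorem convPowDeriv_eq (ρ ρ' : DoubleTensor A →ₗ[ℂ] ℂ) (n : ℕ) :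
    convPowDeriv ρ ρ' n = (∑ k ∈ Finset.range n,
      (n.choose k) • (leftEnd ρ ^ k * (rightEnd ρ - leftEnd ρ) ^ (n - 1 - k))) ρ' := by
  induction n with
  | zero => rfl
  | succ n ih =>
    have hc : Commute (leftEnd ρ) (rightEnd ρ - leftEnd ρ) :=
      (commute_leftEnd_rightEnd ρ).sub_right (Commute.refl _)
    rw [convPowDeriv, ih, ← rightEnd_pow_apply, ← leftEnd_apply, ← Module.End.mul_apply,
      ← LinearMap.add_apply]
    have := pow_sum_succ (leftEnd ρ) (rightEnd ρ - leftEnd ρ) hc n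
    rw [add_sub_cancel] at this
    rw [← this]
    rfl

/-- The weight `(n+1 choose k) / (n+1)!` splits as `1/k!` times `1/(n-k+1)!`, the coefficients of
`exp^⋆` and `W_ρ`; hence the `ħ`-coefficient of degree `n + 1` is the degree `n` part of their
Cauchy product. -/
theorem inv_factorial_smul_convPowDeriv (ρ ρ' : DoubleTensor A →ₗ[ℂ] ℂ) (n : ℕ) :
    ((n + 1).factorial : ℂ)⁻¹ • convPowDeriv ρ ρ' (n + 1) =
      ∑ k ∈ Finset.range (n + 1), starMul (expTerm ρ k) (wTerm ρ ρ' (n - k)) := by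
  rw [convPowDeriv_eq, LinearMap.sum_apply, Finset.smul_sum]
  refine Finset.sum_congr rfl fun k hk => ?_
  have hk' : k ≤ n := Nat.lt_succ_iff.1 (Finset.mem_range.1 hk)
  rw [expTerm, wTerm, adBracket_iterate, starMul_smul_left, starMul_smul_right,
    starMul_smul_right, ← leftEnd_pow_apply, LinearMap.smul_apply, Module.End.mul_apply,
    ← Nat.cast_smul_eq_nsmul ℂ, smul_smul, smul_smul, smul_smul,
    Nat.add_sub_cancel]
  congr 1
  -- One sign comes from the definition of `W_ρ`, the other from `ad_ρ = -(R - L)`.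
  have h1 : (-1 : ℂ) ^ (n - k) * (-1) ^ (n - k) = 1 := by
    rw [← mul_pow]
    simp
  have h2 : (((n + 1).choose k : ℕ) : ℂ) * (k.factorial * (n - k + 1).factorial) =
      (n + 1).factorial := by
    have := Nat.choose_mul_factorial_mul_factorial (Nat.le_succ_of_le hk')
    rw [show n.succ - k = n - k + 1 by omega] at this
    rw [← mul_assoc]
    exact_mod_cast this
  have hc : ((n + 1).choose k : ℂ) ≠ 0 :=
    Nat.cast_ne_zero.2 (Nat.choose_pos (Nat.le_succ_of_le hk')).ne'
  have hkf : (k.factorial : ℂ) ≠ 0 := Nat.cast_ne_zero.2 (Nat.factorial_ne_zero _)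
  have hm : ((n - k + 1).factorial : ℂ) ≠ 0 := Nat.cast_ne_zero.2 (Nat.factorial_ne_zero _)
  have h3 : (-1 : ℂ) ^ (n - k) / ((n - k + 1).factorial : ℂ) * (-1) ^ (n - k) =
      ((n - k + 1).factorial : ℂ)⁻¹ := by
    rw [div_mul_eq_mul_div, h1, one_div]
  have h4 : ((n + 1).factorial : ℂ)⁻¹ * ((n + 1).choose k : ℂ) =
      (k.factorial : ℂ)⁻¹ * ((n - k + 1).factorial : ℂ)⁻¹ := by
    rw [← h2]
    field_simp
  rw [h4, ← h3]
  ring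

theorem adBracket_iterate_mem_vanishing {ρ ρ' : DoubleTensor A →ₗ[ℂ] ℂ} (hρ : ρ 1 = 0) (n : ℕ) :
    (adBracket ρ)^[n] ρ' ∈ vanishing A ℂ n := by
  induction n with
  | zero => exact mem_vanishing_zero _
  | succ n ih =>
    rw [Function.iterate_succ_apply', adBracket]
    refine Submodule.sub_mem _ ?_ (starMul_mem_vanishing ih (mem_vanishing_one hρ))
    have h := starMul_mem_vanishing (mem_vanishing_one hρ) ih
    rwa [add_comm] at h

theorem wTerm_mem_vanishing {ρ ρ' : DoubleTensor A →ₗ[ℂ] ℂ} (hρ : ρ 1 = 0) (n : ℕ) :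
    wTerm ρ ρ' n ∈ vanishing A ℂ n :=
  Submodule.smul_mem _ _ (adBracket_iterate_mem_vanishing hρ n)

theorem expTerm_mem_vanishing {R : Type*} [CommRing R] [Algebra ℂ R]
    {f : DoubleTensor A →ₗ[ℂ] R} (hf : f 1 = 0) (n : ℕ) : expTerm f n ∈ vanishing A R n :=
  Submodule.smul_mem _ _ (convPow_mem_vanishing hf n)

/-- Modulo functionals of order `N`, both sides equal the sum of `expTerm ρ k ⋆ wTerm ρ ρ' m` over
`k + m < N`. Comparing truncations avoids any rearrangement of infinite series. -/
theorem eq_starMul_wMap {ρ ρ' Φ Φ' : DoubleTensor A →ₗ[ℂ] ℂ} (hρ : ρ 1 = 0) (hρ' : ρ' 1 = 0)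
    (h : grassmann Φ Φ' = convExp (grassmann ρ ρ')) : Φ' = starMul Φ (wMap ρ ρ') := by
  have hg1 : grassmann ρ ρ' 1 = 0 := by
    apply TrivSqZeroExt.ext <;> simp [fst_grassmann, snd_grassmann, hρ, hρ']
  have hE : ∀ N, grassmann Φ Φ' - ∑ n ∈ Finset.range N, expTerm (grassmann ρ ρ') n ∈
      vanishing A (DualNumber ℂ) N := fun N => by
    rw [h]
    exact seriesSum_sub_mem (expTerm_mem_vanishing hg1) N
  have hfst : ∀ N, Φ - ∑ n ∈ Finset.range N, expTerm ρ n ∈ vanishing A ℂ N := fun N => by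
    convert comp_mem_vanishing (hE N) (TrivSqZeroExt.fstHom ℂ ℂ ℂ).toLinearMap using 1
    ext1 x
    simp [expTerm, convPow_grassmann, fst_grassmann, TrivSqZeroExt.fst_sum]
  have hsnd : ∀ N, Φ' - ∑ n ∈ Finset.range N, ((n.factorial : ℂ)⁻¹ • convPowDeriv ρ ρ' n) ∈
      vanishing A ℂ N := fun N => by
    convert comp_mem_vanishing (hE N) (TrivSqZeroExt.sndHom ℂ ℂ) using 1
    ext1 x
    simp [expTerm, convPow_grassmann, snd_grassmann, TrivSqZeroExt.snd_sum]
  rw [← sub_eq_zero]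
  refine eq_zero_of_forall_mem_vanishing fun N => ?_
  have h1 : starMul Φ (wMap ρ ρ') - ∑ k ∈ Finset.range N, starMul (expTerm ρ k) (wMap ρ ρ') ∈
      vanishing A ℂ N := by
    convert starMul_mem_vanishing (hfst N) (mem_vanishing_zero (wMap ρ ρ')) using 1
    · rfl
    · rw [starMul_sub_left, starMul_sum_left]
  -- The `k`-th exponential term already has order `k`, so the second series need only be cut at `N
  -- - k`.
  have h2 : ∑ k ∈ Finset.range N, starMul (expTerm ρ k) (wMap ρ ρ') -
      ∑ k ∈ Finset.range N, ∑ m ∈ Finset.range (N - k),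
        starMul (expTerm ρ k) (wTerm ρ ρ' m) ∈ vanishing A ℂ N := by
    rw [← Finset.sum_sub_distrib]
    refine Submodule.sum_mem _ fun k hk => ?_
    convert starMul_mem_vanishing (expTerm_mem_vanishing hρ k)
      (seriesSum_sub_mem (wTerm_mem_vanishing (ρ' := ρ') hρ) (N - k)) using 1
    · rw [Nat.add_sub_cancel' (Finset.mem_range.1 hk).le]
    · rw [starMul_sub_right, starMul_sum_right]
      rfl
  -- Truncation at `N + 1` leaves `N` terms once the zero derivative of the `0`-th power is dropped.
  have h3 := vanishing_antitone (Nat.le_succ N) (hsnd (N + 1))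
  rw [Finset.sum_range_succ'] at h3
  rw [show convPowDeriv ρ ρ' 0 = 0 from rfl, smul_zero, add_zero] at h3
  simp only [inv_factorial_smul_convPowDeriv] at h3
  rw [Finset.sum_range_diag_flip N (fun k m => starMul (expTerm ρ k) (wTerm ρ ρ' m))] at h3
  convert Submodule.sub_mem _ (Submodule.sub_mem _ h3 h1) h2 using 1
  abel

end ShuffleCumulant

end

/-! ### The proposition -/

open ShuffleCumulant in
theorem mainTheorem5 {A : Type*} [Ring A] [Algebra ℂ A] (φ φ' : A →ₗ[ℂ] ℂ)
    (hφ : φ 1 = 1) (hφ' : φ' 1 = 0)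
    (κ κ' β β' ρ ρ' : DoubleTensor A →ₗ[ℂ] ℂ)
    (hκ : IsInfinitesimalCharacter (grassmann κ κ'))
    (hκΦ : grassmannMoment φ φ' = eps + precMul (grassmann κ κ') (grassmannMoment φ φ'))
    (hβ : IsInfinitesimalCharacter (grassmann β β'))
    (hβΦ : grassmannMoment φ φ' = eps + succMul (grassmannMoment φ φ') (grassmann β β'))
    (hρ : IsInfinitesimalCharacter (grassmann ρ ρ'))
    (hρΦ : grassmannMoment φ φ' = convExp (grassmann ρ ρ')) :
    IsConvInverse (moment φ) (convInv (moment φ)) ∧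
    LocallyFiniteSeries (wTerm ρ ρ') ∧
    infMoment φ φ' = starMul (moment φ) (shuffleAdjoint (moment φ) κ') ∧
    infMoment φ φ' = starMul (shuffleAdjoint (convInv (moment φ)) β') (moment φ) ∧
    infMoment φ φ' = starMul (moment φ) (wMap ρ ρ') := by
  have hinv : IsConvInverse (moment φ) (convInv (moment φ)) :=
    isConvInverse_convInv (by simp [moment])
  have hρ1 := apply_one_of_grassmann hρ
  rw [grassmannMoment_eq] at hκΦ hβΦ hρΦ
  rw [precMul, convolve_grassmann, eps_eq_grassmann, grassmann_add] at hκΦ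
  rw [succMul, convolve_grassmann, eps_eq_grassmann, grassmann_add] at hβΦ
  -- The two components are the fixed-point equation of `Φ` and its linearisation, satisfied by
  -- `Φ'`.
  have hκ2 := grassmann_inj hκΦ
  have hβ2 := grassmann_inj hβΦ
  refine ⟨hinv, locallyFiniteSeries_of_mem (wTerm_mem_vanishing hρ1.1), ?_, ?_,
    eq_starMul_wMap hρ1.1 hρ1.2 hρΦ⟩
  · refine eq_starMul_shuffleAdjoint hinv (apply_one_of_grassmann hκ).1 hκ2.1 ?_
    refine hκ2.2.trans ?_
    rw [zero_add, add_comm]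
    rfl
  · refine eq_shuffleAdjoint_starMul hinv (apply_one_of_grassmann hβ).1 hβ2.1 ?_
    refine hβ2.2.trans ?_
    rw [zero_add]
    rfl
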